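/- **Setting.** Let $\beta^*\in\mathbb{R}^p$ with $\|\beta^*\|_2=1$, let $f:\mathbb{R}\to[-1,1]$ be a link function, and let $(y_1,x_1),\dots,(y_n,x_n)$, $n$ even, be i.i.d. copies of a pair $(Y,X)\in\{-1,1\}\times\mathbb{R}^p$ with $X\sim\mathcal N(0,I_p)$ and $\mathbb{P}(Y=1\mid X)=\tfrac12 f(\langle X,\beta^*\rangle)+\tfrac12$. With $Z\sim\mathcal N(0,1)$ put $\mu_k=\mathbb{E}[f(Z)Z^k]$, $\phi(f)=\mu_1^2-\mu_0\mu_2+\mu_0^2$, $$\gamma=\frac12\left[\frac{1-\mu_0^2}{\phi(f)+1-\mu_0^2}+1\right],\qquad \xi=\frac{\gamma\,\phi(f)+(\gamma-1)(1-\mu_0^2)}{(1+\gamma)\,[\phi(f)+1-\mu_0^2]}.$$ **Algorithm.** Form $M=\frac2n\sum_{i=1}^{n/2}(y_{2i}-y_{2i-1})^2(x_{2i}-x_{2i-1})(x_{2i}-x_{2i-1})^\top$ and, from a unit vector $\beta^0\in\mathbb{R}^p$, iterate $\beta^{t}=M\beta^{t-1}/\|M\beta^{t-1}\|_2$ (with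 $\beta^t=0$ if $M\beta^{t-1}=0$). **Corollary.** There are absolute constants $C_1,C_2,C_3>0$ such that the following holds for each of the three models below, with the factor $r$ stated there. One has $\phi(f)>0$. Moreover, for all $p$, all unit $\beta^*\in\mathbb{R}^p$ and all even $n\ge C_1p/\xi^2$, there is an event of probability at least $1-2\exp(-C_2p)$ on which, for every unit vector $\beta^0$ and every unit eigenvector $\hat\beta$ of $M$ for its largest eigenvalue, oriented so that $\langle\hat\beta,\beta^*\rangle\ge0$, such that $\alpha:=\langle\beta^0,\hat\beta\rangle\ne0$: the inequality $$\sqrt{\frac{1-\alpha^2}{\alpha^2}}\;\gamma^{T}\le r\sqrt{\frac pn}\qquad(\ast)$$ holds for all sufficiently large $T$, and for every $T=T_{\max}\ge 0$ satisfying $(\ast)$, $$\bigl\|\beta^{T}-\operatorname{sign}(\alpha)\,\beta^*\bigr\|_2\le C_3\, r\,\sqrt{\frac pn}.$$ * *Flipped logistic regression* (zero intercept), $p_{\rm e}\in[0,\frac12)$: $f(z)=\frac{e^z-1}{e^z+1}+2p_{\rm e}\frac{1-e^z}{1+e^z}$ and $r=\max\{1,(1-2p_{\rm e})^{-2}\}$.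 * *Robust one-bit compressed sensing* $Y=\operatorname{sign}(\langle X,\beta^*\rangle+\epsilon)$, $\epsilon\sim\mathcal N(0,\sigma^2)$ independent of $X$, $\sigma\ge0$: $f(z)=2\,\mathbb{P}(z+\epsilon>0)-1$ and $r=\max\{1,\sigma^2\}$. * *One-bit phase retrieval* $Y=\operatorname{sign}(|\langle X,\beta^*\rangle|-\theta)$, $\theta>\theta_{\rm m}$, where $\mathbb{P}(|Z|\ge\theta_{\rm m})=\frac12$: $f(z)=\operatorname{sign}(|z|-\theta)$ and $r=\max\bigl\{1,\frac{1}{\theta(\theta-\theta_{\rm m})\exp(-\theta^2)}\bigr\}$. -/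

import Mathlib

open MeasureTheory ProbabilityTheory
open scoped RealInnerProductSpace

universe u

noncomputable section

namespace OneBit

/-! ### Link functions of the example models -/

/-- Flipped logistic regression with flipping probability `pe` and intercept `0`. -/
def flippedLogisticLink (pe : ℝ) (z : ℝ) : ℝ :=
  (Real.exp z - 1) / (Real.exp z + 1) + 2 * pe * ((1 - Real.exp z) / (1 + Real.exp z))

/-- Robust one-bit compressed sensing `Y = sign (⟪X, β⟫ + ε)` with `ε ∼ N(0, σ²)`:
`f z = 2 ℙ(z + ε > 0) - 1`, that is, `2 ∫_0^∞ (√(2π) σ)⁻¹ exp (-(u - z)² / (2σ²)) du - 1`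
when `σ > 0`, and the sign function (with value `-1` at `0`) when `σ = 0`. -/
def robustOneBitLink (σ : ℝ) (z : ℝ) : ℝ :=
  2 * (gaussianReal z (Real.toNNReal (σ ^ 2))).real (Set.Ioi 0) - 1

/-- One-bit phase retrieval `Y = sign (|⟪X, β⟫| - θ)`. -/
def phaseRetrievalLink (θ : ℝ) (z : ℝ) : ℝ := Real.sign (|z| - θ)

/-! ### Moments of a link function -/

/-- `μ_k = 𝔼[f(Z) Z^k]` with `Z ∼ N(0, 1)`. -/
def mu (f : ℝ → ℝ) (k : ℕ) : ℝ := ∫ z, f z * z ^ k ∂(gaussianReal 0 1)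

/-- `φ(f) = μ₁² - μ₀ μ₂ + μ₀²`. -/
def phi (f : ℝ → ℝ) : ℝ := mu f 1 ^ 2 - mu f 0 * mu f 2 + mu f 0 ^ 2

/-- The geometric rate `γ` of the power iteration. -/
def gam (f : ℝ → ℝ) : ℝ :=
  ((1 - mu f 0 ^ 2) / (phi f + 1 - mu f 0 ^ 2) + 1) / 2

/-- The perturbation level `ξ` that governs the sample size. -/
def xi (f : ℝ → ℝ) : ℝ :=
  (gam f * phi f + (gam f - 1) * (1 - mu f 0 ^ 2)) /
    ((1 + gam f) * (phi f + 1 - mu f 0 ^ 2))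

/-! ### The data and the algorithm -/

/-- `(y i, x i)`, `i < n`, are i.i.d. copies of a pair `(Y, X)` with `X ∼ N(0, I_p)`,
`Y ∈ {-1, 1}` and `ℙ(Y = 1 | X) = f(⟪X, β⟫) / 2 + 1 / 2`. -/
structure IsSample {Ω : Type u} [MeasurableSpace Ω] (P : Measure Ω) (f : ℝ → ℝ) {p n : ℕ}
    (β : EuclideanSpace ℝ (Fin p)) (y : Fin n → Ω → ℝ)
    (x : Fin n → Ω → EuclideanSpace ℝ (Fin p)) : Prop where
  measurable_x : ∀ i, Measurable (x i)
  measurable_y : ∀ i, Measurable (y i)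
  indep : iIndepFun (fun i ω => (y i ω, x i ω)) P
  law_x : ∀ i, P.map (x i) = stdGaussian (EuclideanSpace ℝ (Fin p))
  binary : ∀ i, ∀ᵐ ω ∂P, y i ω = -1 ∨ y i ω = 1
  cond_y : ∀ i,
    P[Set.indicator {ω | y i ω = 1} (fun _ => (1 : ℝ)) |
      MeasurableSpace.comap (x i) inferInstance]
      =ᵐ[P] fun ω => f ⟪x i ω, β⟫ / 2 + 1 / 2

/-- The second moment estimator `M`, built from the differences of the `n / 2` consecutive pairs
(indices start at `0`). -/
def momentMatrix {p n : ℕ} (y : Fin n → ℝ) (x : Fin n → EuclideanSpace ℝ (Fin p)) :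
    Matrix (Fin p) (Fin p) ℝ :=
  (2 / (n : ℝ)) • ∑ i : Fin (n / 2),
    (y ⟨2 * i + 1, by omega⟩ - y ⟨2 * i, by omega⟩) ^ 2 •
      Matrix.vecMulVec
        (x ⟨2 * i + 1, by omega⟩ - x ⟨2 * i, by omega⟩).ofLp
        (x ⟨2 * i + 1, by omega⟩ - x ⟨2 * i, by omega⟩).ofLp

/-- The power iteration: `β^{t+1} = M β^t / ‖M β^t‖₂`. -/
def powerIterate {p : ℕ} (M : Matrix (Fin p) (Fin p) ℝ) (β₀ : EuclideanSpace ℝ (Fin p)) :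
    ℕ → EuclideanSpace ℝ (Fin p)
  | 0 => β₀
  | t + 1 => ‖M.toEuclideanLin (powerIterate M β₀ t)‖⁻¹ •
      M.toEuclideanLin (powerIterate M β₀ t)

/-- `v` is a unit eigenvector of `M` for the largest eigenvalue. -/
def IsLeadingEigenvector {p : ℕ} (M : Matrix (Fin p) (Fin p) ℝ)
    (v : EuclideanSpace ℝ (Fin p)) : Prop :=
  ‖v‖ = 1 ∧ ∃ l : ℝ, M.toEuclideanLin v = l • v ∧
    ∀ l' : ℝ, Module.End.HasEigenvalue M.toEuclideanLin l' → l' ≤ l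

/-- The optimization error `√((1 - α²) / α²) γ^t` after `t` iterations. -/
def optError (f : ℝ → ℝ) (α : ℝ) (t : ℕ) : ℝ :=
  √((1 - α ^ 2) / α ^ 2) * gam f ^ t

/-- For data with link function `f`, a parameter `βs` on the unit sphere and an even sample size
`n ≥ C₁ p / ξ²`, with probability at least `1 - 2 exp (-C₂ p)` the algorithm started at any unit
vector `β₀` attains the error `C₃ r √(p / n)` after sufficiently many iterations, namely as soon as
the optimization error is at most `r √(p / n)`. Here `α = ⟪β₀, v⟫ ≠ 0`, where `v` is a leading
eigenvector of the moment matrix, oriented so that `⟪v, βs⟫ ≥ 0`; the iterates started at `-β₀` are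
the negatives of those started at `β₀`, so the sign of `α` decides between `βs` and `-βs`. -/
def AttainsRate (C₁ C₂ C₃ : ℝ) (f : ℝ → ℝ) (r : ℝ) : Prop :=
  ∀ (Ω : Type u) [MeasurableSpace Ω] (P : Measure Ω) [IsProbabilityMeasure P] (p n : ℕ)
    (βs : EuclideanSpace ℝ (Fin p)) (y : Fin n → Ω → ℝ)
    (x : Fin n → Ω → EuclideanSpace ℝ (Fin p)),
    ‖βs‖ = 1 → Even n → C₁ * p / xi f ^ 2 ≤ n → IsSample P f βs y x →
    ∃ G : Set Ω, MeasurableSet G ∧ 1 - 2 * Real.exp (-C₂ * p) ≤ P.real G ∧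
      ∀ ω ∈ G, ∀ β₀ v : EuclideanSpace ℝ (Fin p), ‖β₀‖ = 1 →
        IsLeadingEigenvector (momentMatrix (fun i => y i ω) (fun i => x i ω)) v →
        0 ≤ ⟪v, βs⟫ → ⟪β₀, v⟫ ≠ 0 →
        (∃ T₀ : ℕ, ∀ T ≥ T₀, optError f ⟪β₀, v⟫ T ≤ r * √((p : ℝ) / n)) ∧
        ∀ T : ℕ, optError f ⟪β₀, v⟫ T ≤ r * √((p : ℝ) / n) →
          ‖powerIterate (momentMatrix (fun i => y i ω) (fun i => x i ω)) β₀ T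
            - Real.sign ⟪β₀, v⟫ • βs‖ ≤ C₃ * (r * √((p : ℝ) / n))

end OneBit

end

/-!
The moment matrix `M` has expectation `Σ = 4 (1 - μ₀²) I + 4 φ β βᵀ`, a spiked operator with spectral
gap `4 φ(f)`. Indeed `(Y' - Y)² = 2 (1 - Y Y')`, conditioning on `X` replaces `Y` by `f(⟪X, β⟫)`
(`IsSample.integral_mul_comp`), and the components of `X` along `β` and orthogonal to it are
independent (`IsSample.integral_pair`).

For a fixed `u` in the unit ball, `⟪M u, u⟫` is an average of `n / 2` independent nonnegative variables
whose exponential moments are bounded by an absolute constant, so a Chernoff bound with exponent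
`√(2 p / n)` and a union bound over a `1 / 2`-net with at most `5 ^ p` points give
`‖M - Σ‖ ≤ K √(p / n)` with probability at least `1 - 2 exp (-p)`
(`IsSample.exists_concentration`).

If `‖M - Σ‖ ≤ δ ≤ φ / 4`, the leading eigenvector `v` satisfies `‖v - β‖ ≤ δ / φ`, and on the orthogonal
complement of `v` the operator `M` is at most `γ` times its largest eigenvalue. Hence the tangent of
the angle between the iterates and `v` decays like `γ ^ t`, and the total error is at most
`2 √((1 - α²) / α²) γ ^ t + δ / φ` (`norm_powerIterate_sub_le_of_perturbation`).

In each of the three models `r φ(f)` is bounded below by an absolute constant: when the link is odd,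
`μ₀ = 0` and `φ = μ₁²`; for phase retrieval `μ₀ - μ₂` and the distance of `μ₀` from `0` are expressed
through the Gaussian density at `θ`. So the relative perturbation `δ / φ` is at most a constant times
`r √(p / n)`. If `r √(p / n)` is not small, the error bound holds trivially, since the iterates have
norm at most `1`; otherwise `δ ≤ φ / 4` and the preceding estimates apply
(`attainsRate_of_le_mul_phi`).
-/

noncomputable section

namespace OneBit

/-! ### Nets and perturbation of a spiked operator -/

section Net

variable {E : Type*} [NormedAddCommGroup E] [InnerProductSpace ℝ E] [FiniteDimensional ℝ E]

/-- A maximal `1 / 2`-separated subset of the unit ball is a `1 / 2`-net. -/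
theorem exists_half_net :
    ∃ N : Finset E, N.card ≤ 5 ^ Module.finrank ℝ E ∧ (∀ x ∈ N, ‖x‖ ≤ 1) ∧
      ∀ x : E, ‖x‖ ≤ 1 → ∃ v ∈ N, ‖x - v‖ ≤ 1 / 2 := by
  classical
  let S : Set ℕ := {k | ∃ N : Finset E, N.card = k ∧ (∀ x ∈ N, ‖x‖ ≤ 1) ∧
    ∀ c ∈ N, ∀ d ∈ N, c ≠ d → 1 / 2 ≤ ‖c - d‖}
  have hcard : ∀ N : Finset E, (∀ x ∈ N, ‖x‖ ≤ 1) →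
      (∀ c ∈ N, ∀ d ∈ N, c ≠ d → 1 / 2 ≤ ‖c - d‖) → N.card ≤ 5 ^ Module.finrank ℝ E := by
    intro N h1 h2
    have hinj : Function.Injective (fun x : E => (2 : ℝ) • x) :=
      fun a b h => smul_right_injective E (two_ne_zero' ℝ) h
    rw [← Finset.card_image_of_injective N hinj]
    refine Besicovitch.card_le_of_separated _ ?_ ?_
    · simp only [Finset.mem_image, forall_exists_index, and_imp, forall_apply_eq_imp_iff₂]
      intro a ha
      rw [norm_smul, Real.norm_ofNat]
      linarith [h1 a ha]
    · simp only [Finset.mem_image, forall_exists_index, and_imp, forall_apply_eq_imp_iff₂]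
      intro a ha b hb hab
      rw [← smul_sub, norm_smul, Real.norm_ofNat]
      have := h2 a ha b hb (fun h => hab (by rw [h]))
      linarith
  have hne : S.Nonempty := ⟨0, ∅, by simp⟩
  have hbdd : BddAbove S := ⟨5 ^ Module.finrank ℝ E, by
    rintro k ⟨N, rfl, h1, h2⟩
    exact hcard N h1 h2⟩
  obtain ⟨N, hN, h1, h2⟩ := Nat.sSup_mem hne hbdd
  refine ⟨N, hcard N h1 h2, h1, fun x hx => ?_⟩
  by_contra! hcon
  have hxN : x ∉ N := fun h => by
    have := hcon x h
    rw [sub_self, norm_zero] at this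
    linarith
  have : (insert x N).card ∈ S := by
    refine ⟨_, rfl, ?_, ?_⟩
    · intro z hz
      rcases Finset.mem_insert.1 hz with rfl | hz
      exacts [hx, h1 z hz]
    · intro c hc d hd hcd
      rcases Finset.mem_insert.1 hc with rfl | hc <;> rcases Finset.mem_insert.1 hd with rfl | hd
      · exact absurd rfl hcd
      · exact (hcon d hd).le
      · rw [norm_sub_rev]
        exact (hcon c ‹c ∈ N›).le
      · exact h2 c hc d hd hcd
  have := le_csSup hbdd this
  rw [Finset.card_insert_of_notMem hxN, hN] at this
  omega

/-- Test the form at a net point `w` near an eigenvector `e` of largest absolute eigenvalue `l`: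
writing `a = ⟪e, w⟫`, the form is at least `|l| (a² - (‖w‖² - a²)) ≥ |l| / 4` there in absolute
value. -/
theorem norm_apply_le_of_net {A : E →ₗ[ℝ] E} (hA : A.IsSymmetric) {N : Finset E} {η : ℝ}
    (hη : 0 ≤ η) (hN : ∀ x : E, ‖x‖ ≤ 1 → ∃ v ∈ N, ‖x - v‖ ≤ 1 / 2)
    (hAN : ∀ v ∈ N, |⟪A v, v⟫| ≤ η) (x : E) : ‖A x‖ ≤ 4 * η * ‖x‖ := by
  set b := hA.eigenvectorBasis rfl with hb
  set l := hA.eigenvalues rfl with hl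
  have hAb : ∀ i, A (b i) = l i • b i := fun i => hA.apply_eigenvectorBasis rfl i
  have hcoord : ∀ z i, ⟪b i, A z⟫ = l i * ⟪b i, z⟫ := by
    intro z i
    rw [← hA, hAb, real_inner_smul_left]
  have hl4 : ∀ i, |l i| ≤ 4 * η := by
    intro i₀
    obtain ⟨i, -, hi⟩ := Finset.exists_max_image Finset.univ (fun i => |l i|) ⟨i₀, Finset.mem_univ _⟩
    refine (hi i₀ (Finset.mem_univ _)).trans ?_
    obtain ⟨w, hw, hdist⟩ := hN (b i) (by rw [b.norm_eq_one])
    have hform : ⟪A w, w⟫ = ∑ j, l j * ⟪b j, w⟫ ^ 2 := by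
      rw [← b.sum_inner_mul_inner]
      refine Finset.sum_congr rfl fun j _ => ?_
      rw [real_inner_comm, hcoord]
      ring
    have hnorm : ‖w‖ ^ 2 = ∑ j, ⟪b j, w⟫ ^ 2 := (b.sum_sq_inner_right w).symm
    have hd2 : 1 - 2 * ⟪b i, w⟫ + ‖w‖ ^ 2 ≤ 1 / 4 := by
      have := norm_sub_sq_real (b i) w
      rw [b.norm_eq_one] at this
      nlinarith [norm_nonneg (b i - w)]
    rw [← Finset.add_sum_erase _ _ (Finset.mem_univ i)] at hform hnorm
    set R := ∑ j ∈ Finset.univ.erase i, ⟪b j, w⟫ ^ 2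
    have hR : |∑ j ∈ Finset.univ.erase i, l j * ⟪b j, w⟫ ^ 2| ≤ |l i| * R := by
      refine (Finset.abs_sum_le_sum_abs _ _).trans ?_
      rw [Finset.mul_sum]
      refine Finset.sum_le_sum fun j _ => ?_
      rw [abs_mul, abs_of_nonneg (sq_nonneg ⟪b j, w⟫)]
      exact mul_le_mul_of_nonneg_right (hi j (Finset.mem_univ _)) (sq_nonneg _)
    have h1 : |l i| * ⟪b i, w⟫ ^ 2 ≤ η + |l i| * R := by
      have e : |l i| * ⟪b i, w⟫ ^ 2 = |l i * ⟪b i, w⟫ ^ 2| := by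
        rw [abs_mul, abs_of_nonneg (sq_nonneg ⟪b i, w⟫)]
      rw [e, show l i * ⟪b i, w⟫ ^ 2
        = ⟪A w, w⟫ - ∑ j ∈ Finset.univ.erase i, l j * ⟪b j, w⟫ ^ 2 by rw [hform]; ring]
      exact (abs_sub _ _).trans (add_le_add (hAN w hw) hR)
    have h2 : (1 : ℝ) / 4 ≤ ⟪b i, w⟫ ^ 2 - R := by
      nlinarith [sq_nonneg (⟪b i, w⟫ - 1 / 2)]
    nlinarith [abs_nonneg (l i), mul_le_mul_of_nonneg_left h2 (abs_nonneg (l i))]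
  refine le_of_sq_le_sq ?_ (by positivity)
  rw [← b.sum_sq_inner_right, mul_pow, ← b.sum_sq_inner_right x, Finset.mul_sum]
  refine Finset.sum_le_sum fun i _ => ?_
  rw [hcoord, mul_pow]
  refine mul_le_mul_of_nonneg_right ?_ (sq_nonneg _)
  rw [← sq_abs]
  exact pow_le_pow_left₀ (abs_nonneg _) (hl4 i) 2

/-- The Rayleigh quotient of a symmetric map is at most any upper bound of its eigenvalues. -/
theorem inner_apply_self_le_of_eigenvalue_le {L : E →ₗ[ℝ] E} (hL : L.IsSymmetric) {l : ℝ}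
    (h : ∀ l', Module.End.HasEigenvalue L l' → l' ≤ l) (x : E) : ⟪L x, x⟫ ≤ l * ‖x‖ ^ 2 := by
  set b := hL.eigenvectorBasis rfl with hb
  rw [← b.sum_inner_mul_inner, ← b.sum_sq_inner_right x, Finset.mul_sum]
  refine Finset.sum_le_sum fun i _ => ?_
  have h1 : ⟪L x, b i⟫ = hL.eigenvalues rfl i * ⟪b i, x⟫ := by
    rw [hL, hL.apply_eigenvectorBasis rfl i, real_inner_smul_right, real_inner_comm]
    rfl
  rw [h1]
  have := h _ (hL.hasEigenvalue_eigenvalues rfl i)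
  have := mul_le_mul_of_nonneg_right this (sq_nonneg ⟪b i, x⟫)
  simp only [RCLike.ofReal_real_eq_id, id_eq] at this
  linarith

end Net

section Perturbation

variable {E : Type*} [NormedAddCommGroup E] [InnerProductSpace ℝ E]

/-- The spiked operator `a I + b β βᵀ`. -/
def spiked (a b : ℝ) (β : E) : E →ₗ[ℝ] E :=
  a • LinearMap.id + b • (innerₛₗ ℝ β).smulRight β

theorem spiked_apply (a b : ℝ) (β z : E) : spiked a b β z = a • z + (b * ⟪β, z⟫) • β := by
  simp [spiked, mul_smul]

theorem isSymmetric_spiked (a b : ℝ) (β : E) : (spiked a b β).IsSymmetric := by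
  intro x y
  simp only [spiked_apply, inner_add_left, inner_add_right, real_inner_smul_left,
    real_inner_smul_right]
  rw [real_inner_comm x β]
  ring

/-- The sine of the angle between the leading eigenvector of a perturbed spiked operator and the
spike is at most the relative size of the perturbation. -/
theorem spiked_sin_le {L : E →ₗ[ℝ] E} {β v : E} {c φ δ l : ℝ} (hδφ : δ ≤ φ / 4)
    (hβ : ‖β‖ = 1) (hv : ‖v‖ = 1) (hLv : L v = l • v)
    (hl : 4 * (c + φ) - δ ≤ l) (hφ : 0 < φ)
    (hpert : ∀ z, ‖(L - spiked (4 * c) (4 * φ) β) z‖ ≤ δ * ‖z‖) :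
    ‖v - ⟪v, β⟫ • β‖ ≤ δ / (3 * φ) := by
  set w := v - ⟪v, β⟫ • β with hw
  have hwβ : ⟪w, β⟫ = 0 := by
    rw [hw, inner_sub_left, real_inner_smul_left, real_inner_self_eq_norm_sq, hβ]
    ring
  have hvw : ⟪v, w⟫ = ‖w‖ ^ 2 := by
    rw [← real_inner_self_eq_norm_sq]
    nth_rewrite 2 [hw]
    rw [inner_sub_left, real_inner_smul_left, real_inner_comm w β, hwβ]
    ring
  have h1 : ⟪(L - spiked (4 * c) (4 * φ) β) v, w⟫ = (l - 4 * c) * ‖w‖ ^ 2 := by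
    rw [LinearMap.sub_apply, hLv, spiked_apply, inner_sub_left, inner_add_left,
      real_inner_smul_left, real_inner_smul_left, real_inner_smul_left, hvw,
      real_inner_comm w β, hwβ]
    ring
  have h2 : ⟪(L - spiked (4 * c) (4 * φ) β) v, w⟫ ≤ δ * ‖w‖ := by
    refine (real_inner_le_norm _ _).trans ?_
    have := hpert v
    rw [hv, mul_one] at this
    exact mul_le_mul_of_nonneg_right this (norm_nonneg _)
  rw [h1] at h2
  rcases (norm_nonneg w).eq_or_lt with h0 | h0
  · rw [← h0]
    have := (norm_nonneg _).trans (hpert v)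
    rw [hv, mul_one] at this
    positivity
  · rw [le_div_iff₀ (by positivity)]
    have h3 : (l - 4 * c) * ‖w‖ ≤ δ := by
      refine le_of_mul_le_mul_right ?_ h0
      linarith [h2, sq ‖w‖, mul_assoc (l - 4 * c) ‖w‖ ‖w‖]
    nlinarith

theorem norm_sub_le_sqrt_two_mul_sin {β v : E} (hβ : ‖β‖ = 1) (hv : ‖v‖ = 1) (hvβ : 0 ≤ ⟪v, β⟫) :
    ‖v - β‖ ≤ √2 * ‖v - ⟪v, β⟫ • β‖ := by
  set w := v - ⟪v, β⟫ • β with hw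
  have h1 : ‖w‖ ^ 2 = 1 - ⟪v, β⟫ ^ 2 := by
    rw [hw, norm_sub_sq_real, hv, real_inner_smul_right, norm_smul, hβ, Real.norm_eq_abs, mul_one,
      sq_abs]
    ring
  have h2 : ‖v - β‖ ^ 2 = 2 - 2 * ⟪v, β⟫ := by
    rw [norm_sub_sq_real, hv, hβ]
    ring
  have h3 : ⟪v, β⟫ ≤ 1 := by
    have := real_inner_le_norm v β
    rwa [hv, hβ, one_mul] at this
  refine le_of_sq_le_sq ?_ (by positivity)
  rw [mul_pow, Real.sq_sqrt zero_le_two, h1, h2]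
  nlinarith

/-- A perturbed spiked operator contracts the orthogonal complement of its leading eigenvector,
relative to the leading eigenvalue, at the rate `γ`. -/
theorem spiked_contract {L : E →ₗ[ℝ] E} {β v : E} {c φ δ l : ℝ} (hc : 0 ≤ c) (hφ : 0 < φ)
    (hδφ : δ ≤ φ / 4) (hβ : ‖β‖ = 1) (hl : 4 * (c + φ) - δ ≤ l)
    (hpert : ∀ z, ‖(L - spiked (4 * c) (4 * φ) β) z‖ ≤ δ * ‖z‖)
    (hsin : ‖v - ⟪v, β⟫ • β‖ ≤ δ / (3 * φ)) (hv : ‖v‖ = 1) {z : E} (hz : ⟪z, v⟫ = 0) :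
    ‖L z‖ ≤ ((c / (φ + c) + 1) / 2) * l * ‖z‖ := by
  have h1 : |⟪β, z⟫| ≤ δ / (3 * φ) * ‖z‖ := by
    have h2 : ⟪β, z⟫ = ⟪β - ⟪v, β⟫ • v, z⟫ := by
      rw [inner_sub_left, real_inner_smul_left, real_inner_comm z v, hz]
      ring
    have h3 : ‖β - ⟪v, β⟫ • v‖ = ‖v - ⟪v, β⟫ • β‖ := by
      rw [← sq_eq_sq₀ (norm_nonneg _) (norm_nonneg _), norm_sub_sq_real, norm_sub_sq_real,
        real_inner_smul_right, real_inner_smul_right, norm_smul, norm_smul, hβ, hv,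
        real_inner_comm v β]
    rw [h2]
    refine (abs_real_inner_le_norm _ _).trans ?_
    rw [h3]
    exact mul_le_mul_of_nonneg_right hsin (norm_nonneg _)
  have h4 : ‖L z‖ ≤ (4 * c + 4 * δ / 3 + δ) * ‖z‖ := by
    have e : L z = (L - spiked (4 * c) (4 * φ) β) z + (4 * c) • z + (4 * φ * ⟪β, z⟫) • β := by
      rw [LinearMap.sub_apply, spiked_apply]
      abel
    rw [e]
    refine (norm_add_le _ _).trans ((add_le_add (norm_add_le _ _) le_rfl).trans ?_)
    rw [norm_smul, norm_smul, hβ, Real.norm_of_nonneg (by positivity : (0 : ℝ) ≤ 4 * c),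
      Real.norm_eq_abs, abs_mul, abs_of_pos (by positivity : (0 : ℝ) < 4 * φ)]
    have h5 : 4 * φ * |⟪β, z⟫| ≤ 4 * δ / 3 * ‖z‖ := by
      calc 4 * φ * |⟪β, z⟫| ≤ 4 * φ * (δ / (3 * φ) * ‖z‖) := by gcongr
        _ = 4 * δ / 3 * ‖z‖ := by field_simp
    linarith [hpert z]
  refine h4.trans (mul_le_mul_of_nonneg_right ?_ (norm_nonneg _))
  have hpos : 0 < φ + c := by linarith
  have h6 : (c / (φ + c) + 1) / 2 = (2 * c + φ) / (2 * (φ + c)) := by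
    field_simp
    ring
  rw [h6, div_mul_eq_mul_div, le_div_iff₀ (by positivity)]
  have h7 : (2 * c + φ) * (4 * c + 15 / 4 * φ) ≤ (2 * c + φ) * l :=
    mul_le_mul_of_nonneg_left (by linarith) (by linarith)
  have h8 : (4 * c + 4 * δ / 3 + δ) * (2 * (φ + c)) ≤ (4 * c + 7 / 12 * φ) * (2 * (φ + c)) :=
    mul_le_mul_of_nonneg_right (by linarith) (by positivity)
  nlinarith [mul_nonneg hc hφ.le, mul_pos hφ hφ]

end Perturbation

section PowerIteration

variable {p : ℕ}

theorem norm_powerIterate_le (M : Matrix (Fin p) (Fin p) ℝ) {β₀ : EuclideanSpace ℝ (Fin p)}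
    (h : ‖β₀‖ ≤ 1) (t : ℕ) : ‖powerIterate M β₀ t‖ ≤ 1 := by
  cases t with
  | zero => exact h
  | succ t =>
    rw [powerIterate, norm_smul, norm_inv, norm_norm]
    exact inv_mul_le_one

/-- The tangent of the angle between the iterate and `v` shrinks by the factor `γ` in each step,
while the component along `v` keeps its sign. -/
theorem powerIterate_decomp {M : Matrix (Fin p) (Fin p) ℝ} (hM : M.toEuclideanLin.IsSymmetric)
    {β₀ v : EuclideanSpace ℝ (Fin p)} {l γ : ℝ} (hv : ‖v‖ = 1) (hl : 0 < l)
    (hLv : M.toEuclideanLin v = l • v) (hγ : 0 ≤ γ)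
    (hcon : ∀ z, ⟪z, v⟫ = 0 → ‖M.toEuclideanLin z‖ ≤ γ * l * ‖z‖) (h0 : ‖β₀‖ = 1)
    (hα : ⟪β₀, v⟫ ≠ 0) (t : ℕ) :
    ∃ (a : ℝ) (z : EuclideanSpace ℝ (Fin p)), powerIterate M β₀ t = a • v + z ∧ ⟪z, v⟫ = 0 ∧
      0 < a * ⟪β₀, v⟫ ∧ ‖powerIterate M β₀ t‖ = 1 ∧
      ‖z‖ ≤ √((1 - ⟪β₀, v⟫ ^ 2) / ⟪β₀, v⟫ ^ 2) * γ ^ t * |a| := by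
  induction t with
  | zero =>
    refine ⟨⟪β₀, v⟫, β₀ - ⟪β₀, v⟫ • v, ?_, ?_, ?_, h0, ?_⟩
    · rw [powerIterate]
      abel
    · rw [inner_sub_left, real_inner_smul_left, real_inner_self_eq_norm_sq, hv]
      ring
    · exact mul_self_pos.2 hα
    · rw [pow_zero, mul_one, Real.sqrt_div' _ (sq_nonneg _), Real.sqrt_sq_eq_abs,
        div_mul_cancel₀ _ (abs_ne_zero.2 hα)]
      refine Real.le_sqrt_of_sq_le ?_
      rw [norm_sub_sq_real, h0, real_inner_smul_right, norm_smul, hv, Real.norm_eq_abs, mul_one,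
        sq_abs]
      linarith
  | succ t ih =>
    obtain ⟨a, z, he, hz, ha, -, hb⟩ := ih
    have ha0 : a ≠ 0 := by
      rintro rfl
      simp at ha
    have himg : M.toEuclideanLin (powerIterate M β₀ t) = (l * a) • v + M.toEuclideanLin z := by
      rw [he, map_add, map_smul, hLv, smul_smul, mul_comm]
    have hort : ⟪M.toEuclideanLin z, v⟫ = 0 := by
      rw [hM, hLv, real_inner_smul_right, hz, mul_zero]
    have hne : M.toEuclideanLin (powerIterate M β₀ t) ≠ 0 := by
      intro h
      have : ⟪M.toEuclideanLin (powerIterate M β₀ t), v⟫ = l * a := by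
        rw [himg, inner_add_left, real_inner_smul_left, real_inner_self_eq_norm_sq, hv, hort]
        ring
      rw [h, inner_zero_left] at this
      exact mul_ne_zero hl.ne' ha0 this.symm
    set s := ‖M.toEuclideanLin (powerIterate M β₀ t)‖ with hs
    have hs0 : 0 < s := norm_pos_iff.2 hne
    refine ⟨s⁻¹ * (l * a), s⁻¹ • M.toEuclideanLin z, ?_, ?_, ?_, ?_, ?_⟩
    · rw [powerIterate, himg, smul_add, smul_smul, ← himg]
    · rw [real_inner_smul_left, hort, mul_zero]
    · have : s⁻¹ * (l * a) * ⟪β₀, v⟫ = s⁻¹ * l * (a * ⟪β₀, v⟫) := by ring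
      rw [this]
      positivity
    · rw [powerIterate, norm_smul, norm_inv, norm_norm]
      exact inv_mul_cancel₀ hs0.ne'
    · rw [norm_smul, norm_inv, norm_norm, ← hs, abs_mul, abs_mul, abs_of_pos (inv_pos.2 hs0),
        abs_of_pos hl]
      calc s⁻¹ * ‖M.toEuclideanLin z‖ ≤ s⁻¹ * (γ * l * ‖z‖) := by gcongr; exact hcon z hz
        _ ≤ s⁻¹ * (γ * l * (√((1 - ⟪β₀, v⟫ ^ 2) / ⟪β₀, v⟫ ^ 2) * γ ^ t * |a|)) := by gcongr
        _ = _ := by rw [pow_succ]; ring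

theorem norm_powerIterate_sub_le {M : Matrix (Fin p) (Fin p) ℝ}
    (hM : M.toEuclideanLin.IsSymmetric)
    {β₀ v : EuclideanSpace ℝ (Fin p)} {l γ : ℝ} (hv : ‖v‖ = 1) (hl : 0 < l)
    (hLv : M.toEuclideanLin v = l • v) (hγ : 0 ≤ γ)
    (hcon : ∀ z, ⟪z, v⟫ = 0 → ‖M.toEuclideanLin z‖ ≤ γ * l * ‖z‖) (h0 : ‖β₀‖ = 1)
    (hα : ⟪β₀, v⟫ ≠ 0) (t : ℕ) :
    ‖powerIterate M β₀ t - Real.sign ⟪β₀, v⟫ • v‖ ≤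
      √2 * (√((1 - ⟪β₀, v⟫ ^ 2) / ⟪β₀, v⟫ ^ 2) * γ ^ t) := by
  obtain ⟨a, z, he, hz, ha, hn, hb⟩ := powerIterate_decomp hM hv hl hLv hγ hcon h0 hα t
  set τ := √((1 - ⟪β₀, v⟫ ^ 2) / ⟪β₀, v⟫ ^ 2) * γ ^ t with hτ
  have hτ0 : 0 ≤ τ := by positivity
  have hsgn : Real.sign ⟪β₀, v⟫ * a = |a| ∧ Real.sign ⟪β₀, v⟫ ^ 2 = 1 := by
    rcases lt_or_gt_of_ne hα with h | h
    · rw [Real.sign_of_neg h, abs_of_neg (by nlinarith)]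
      norm_num
    · rw [Real.sign_of_pos h, abs_of_pos (by nlinarith)]
      norm_num
  have hnz : a ^ 2 + ‖z‖ ^ 2 = 1 := by
    have : ‖a • v + z‖ ^ 2 = a ^ 2 + ‖z‖ ^ 2 := by
      rw [norm_add_sq_real, real_inner_smul_left, real_inner_comm z v, hz, norm_smul, hv,
        Real.norm_eq_abs, mul_one, sq_abs]
      ring
    rw [← this, ← he, hn, one_pow]
  have ha1 : |a| ≤ 1 := by
    rw [abs_le_one_iff_mul_self_le_one]
    nlinarith [sq_nonneg ‖z‖]
  have hd : ‖powerIterate M β₀ t - Real.sign ⟪β₀, v⟫ • v‖ ^ 2 = 2 - 2 * |a| := by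
    rw [norm_sub_sq_real, hn, he, real_inner_smul_right, inner_add_left, real_inner_smul_left,
      real_inner_self_eq_norm_sq, hv, hz, norm_smul, hv, Real.norm_eq_abs, mul_one, sq_abs, hsgn.2]
    linarith [hsgn.1]
  refine le_of_sq_le_sq ?_ (by positivity)
  rw [hd, mul_pow, Real.sq_sqrt zero_le_two]
  have hz2 : ‖z‖ ^ 2 ≤ τ ^ 2 := by
    have : ‖z‖ ≤ τ := hb.trans (mul_le_of_le_one_right hτ0 ha1)
    exact pow_le_pow_left₀ (norm_nonneg _) this 2
  have := sq_abs a
  nlinarith [abs_nonneg a]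

end PowerIteration

/-- On the event that the moment matrix is within `δ` of its expectation, the power iteration
recovers `β` up to the optimization error and the relative perturbation `δ / φ`. -/
theorem norm_powerIterate_sub_le_of_perturbation {p : ℕ} {M : Matrix (Fin p) (Fin p) ℝ}
    (hM : M.toEuclideanLin.IsSymmetric) {β β₀ v : EuclideanSpace ℝ (Fin p)} {c φ δ : ℝ}
    (hc : 0 ≤ c) (hφ : 0 < φ) (hδφ : δ ≤ φ / 4) (hβ : ‖β‖ = 1)
    (hpert : ∀ z, ‖(M.toEuclideanLin - spiked (4 * c) (4 * φ) β) z‖ ≤ δ * ‖z‖)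
    (hv : IsLeadingEigenvector M v) (hvβ : 0 ≤ ⟪v, β⟫) (h0 : ‖β₀‖ = 1) (hα : ⟪β₀, v⟫ ≠ 0)
    (t : ℕ) :
    ‖powerIterate M β₀ t - Real.sign ⟪β₀, v⟫ • β‖ ≤
      2 * (√((1 - ⟪β₀, v⟫ ^ 2) / ⟪β₀, v⟫ ^ 2) * ((c / (φ + c) + 1) / 2) ^ t) + δ / φ := by
  obtain ⟨hv1, l, hLv, hmax⟩ := hv
  have hδ : 0 ≤ δ := by
    have := (norm_nonneg _).trans (hpert β)
    rwa [hβ, mul_one] at this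
  have hl : 4 * (c + φ) - δ ≤ l := by
    -- Compare with the Rayleigh quotient at `β`, where the spiked operator has value `4 (c + φ)`.
    have h1 := inner_apply_self_le_of_eigenvalue_le hM hmax β
    have h2 : -(δ) ≤ ⟪(M.toEuclideanLin - spiked (4 * c) (4 * φ) β) β, β⟫ := by
      have h3 := abs_real_inner_le_norm ((M.toEuclideanLin - spiked (4 * c) (4 * φ) β) β) β
      have h4 := hpert β
      rw [hβ, mul_one] at h3 h4
      exact (abs_le.1 (h3.trans h4)).1
    rw [LinearMap.sub_apply, spiked_apply, inner_sub_left, inner_add_left, real_inner_smul_left,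
      real_inner_smul_left, real_inner_self_eq_norm_sq, hβ] at h2
    rw [hβ] at h1
    linarith
  have hsin := spiked_sin_le hδφ hβ hv1 hLv hl hφ hpert
  have hvb : ‖v - β‖ ≤ δ / φ := by
    refine (norm_sub_le_sqrt_two_mul_sin hβ hv1 hvβ).trans ?_
    have h2 : √2 ≤ 3 := Real.sqrt_le_iff.2 ⟨by norm_num, by norm_num⟩
    calc √2 * ‖v - ⟪v, β⟫ • β‖ ≤ 3 * (δ / (3 * φ)) := by gcongr
      _ = δ / φ := by field_simp
  have hpow := norm_powerIterate_sub_le hM hv1 (by linarith) hLv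
    (by positivity : 0 ≤ (c / (φ + c) + 1) / 2)
    (fun z hz => spiked_contract hc hφ hδφ hβ hl hpert hsin hv1 hz) h0 hα t
  have hsgn : |Real.sign ⟪β₀, v⟫| ≤ 1 := by
    rcases Real.sign_apply_eq ⟪β₀, v⟫ with h | h | h <;> rw [h] <;> norm_num
  have h2 : √2 ≤ 2 := Real.sqrt_le_iff.2 ⟨by norm_num, by norm_num⟩
  have e : powerIterate M β₀ t - Real.sign ⟪β₀, v⟫ • β
      = (powerIterate M β₀ t - Real.sign ⟪β₀, v⟫ • v) + Real.sign ⟪β₀, v⟫ • (v - β) := by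
    rw [smul_sub]
    abel
  rw [e]
  refine (norm_add_le _ _).trans (add_le_add (hpow.trans ?_) ?_)
  · gcongr
  · rw [norm_smul, Real.norm_eq_abs]
    exact (mul_le_of_le_one_left (norm_nonneg _) hsgn).trans hvb

/-! ### Sub-exponential concentration -/

section Concentration

variable {Ω : Type*} [MeasurableSpace Ω] {P : Measure Ω}

/-- Disjoint blocks of an independent family are independent. -/
theorem _root_.ProbabilityTheory.iIndepFun.curry {ι κ 𝓧 : Type*} [MeasurableSpace 𝓧]
    {X : ι × κ → Ω → 𝓧} (hX : ∀ q, Measurable (X q)) (h : iIndepFun X P) :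
    iIndepFun (fun i ω (j : κ) => X (i, j) ω) P := by
  have := h.isProbabilityMeasure
  have : ∀ i j, IsProbabilityMeasure (P.map (X (i, j))) :=
    fun i j => Measure.isProbabilityMeasure_map (hX _).aemeasurable
  rw [iIndepFun_iff_map_fun_eq_infinitePi_map (by fun_prop)]
  have hblock : ∀ i, P.map (fun ω (j : κ) => X (i, j) ω)
      = Measure.infinitePi fun j => P.map (X (i, j)) := fun i =>
    (h.precomp (Prod.mk_right_injective i)).map_fun_eq_infinitePi_map (fun j => hX (i, j))
  simp_rw [hblock]
  rw [← Measure.infinitePi_map_curry (fun i j => P.map (X (i, j))),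
    ← h.map_fun_eq_infinitePi_map hX, Measure.map_map (by fun_prop) (by fun_prop)]
  rfl

theorem exp_le_one_add_add_sq_mul (x : ℝ) : Real.exp x ≤ 1 + x + x ^ 2 * Real.exp |x| := by
  have h := Complex.norm_exp_sub_sum_le_norm_mul_exp (x : ℂ) 2
  simp only [Finset.sum_range_succ, Finset.sum_range_zero, zero_add, pow_zero, pow_one,
    Nat.factorial_zero, Nat.factorial_one, Nat.cast_one, div_one, Complex.norm_real,
    Real.norm_eq_abs, sq_abs] at h
  rw [← Complex.ofReal_exp, ← Complex.ofReal_one, ← Complex.ofReal_add, ← Complex.ofReal_sub,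
    Complex.norm_real, Real.norm_eq_abs] at h
  linarith [le_abs_self (Real.exp x - (1 + x))]

variable {W : Ω → ℝ} {s D : ℝ}

theorem integrable_of_integrable_exp_mul (hs : 0 < s) (hW : Measurable W) (hW0 : ∀ ω, 0 ≤ W ω)
    (hint : Integrable (fun ω => Real.exp (s * W ω)) P) : Integrable W P := by
  refine (hint.const_mul s⁻¹).mono' hW.aestronglyMeasurable (Filter.Eventually.of_forall fun ω => ?_)
  rw [Real.norm_of_nonneg (hW0 ω), ← div_eq_inv_mul, le_div_iff₀ hs]
  linarith [Real.add_one_le_exp (s * W ω)]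

/-- Pointwise bound behind `mgf_centered_le`: the quadratic remainder of the exponential is absorbed by
`exp (s w)`, using `(w - m)² ≤ (8 / s²) exp (s |w - m| / 2)` and `|w - m| ≤ w + m`. -/
theorem exp_mul_centered_le (hs : 0 < s) {m w t : ℝ} (hw : 0 ≤ w) (hm : 0 ≤ m) (hmD : s * m ≤ D)
    (ht : |t| ≤ s / 2) :
    Real.exp (t * (w - m)) ≤
      1 + t * (w - m) + t ^ 2 * (8 / s ^ 2 * (Real.exp D * Real.exp (s * w))) := by
  refine (exp_le_one_add_add_sq_mul _).trans (add_le_add le_rfl ?_)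
  set x := |w - m| with hx
  have hx0 : 0 ≤ x := abs_nonneg _
  have h1 : Real.exp |t * (w - m)| ≤ Real.exp (s / 2 * x) := by
    rw [abs_mul]
    exact Real.exp_le_exp.2 (mul_le_mul_of_nonneg_right ht hx0)
  have h2 : x ^ 2 ≤ 8 / s ^ 2 * Real.exp (s / 2 * x) := by
    have := Real.quadratic_le_exp_of_nonneg (by positivity : 0 ≤ s / 2 * x)
    rw [div_mul_eq_mul_div, le_div_iff₀ (by positivity)]
    nlinarith [mul_nonneg hs.le hx0]
  have h3 : Real.exp (s / 2 * x) * Real.exp (s / 2 * x) ≤ Real.exp D * Real.exp (s * w) := by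
    rw [← Real.exp_add, ← Real.exp_add]
    refine Real.exp_le_exp.2 ?_
    have : x ≤ w + m := abs_le.2 ⟨by linarith, by linarith⟩
    nlinarith
  calc (t * (w - m)) ^ 2 * Real.exp |t * (w - m)|
      = t ^ 2 * (x ^ 2 * Real.exp |t * (w - m)|) := by rw [hx, sq_abs]; ring
    _ ≤ t ^ 2 * (8 / s ^ 2 * Real.exp (s / 2 * x) * Real.exp (s / 2 * x)) := by gcongr
    _ = t ^ 2 * (8 / s ^ 2 * (Real.exp (s / 2 * x) * Real.exp (s / 2 * x))) := by ring
    _ ≤ _ := by gcongr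

variable [IsProbabilityMeasure P]

/-- A nonnegative variable with an exponential moment is, once centred, sub-exponential. -/
theorem mgf_centered_le (hs : 0 < s) (hW : Measurable W) (hW0 : ∀ ω, 0 ≤ W ω)
    (hint : Integrable (fun ω => Real.exp (s * W ω)) P)
    (hD : ∫ ω, Real.exp (s * W ω) ∂P ≤ D) {t : ℝ} (ht : |t| ≤ s / 2) :
    Integrable (fun ω => Real.exp (t * (W ω - ∫ ω', W ω' ∂P))) P ∧
    mgf (fun ω => W ω - ∫ ω', W ω' ∂P) P t ≤
      Real.exp (8 / s ^ 2 * (Real.exp D * D) * t ^ 2) := by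
  have hWi := integrable_of_integrable_exp_mul hs hW hW0 hint
  set m := ∫ ω', W ω' ∂P with hm
  have hm0 : 0 ≤ m := integral_nonneg hW0
  have hmD : s * m ≤ D := by
    rw [hm, ← integral_const_mul]
    refine (integral_mono (hWi.const_mul s) hint fun ω => ?_).trans hD
    show s * W ω ≤ Real.exp (s * W ω)
    linarith [Real.add_one_le_exp (s * W ω)]
  have hle := fun ω => exp_mul_centered_le hs (hW0 ω) hm0 hmD ht
  have hdom : Integrable (fun ω => 1 + t * (W ω - m) +
      t ^ 2 * (8 / s ^ 2 * (Real.exp D * Real.exp (s * W ω)))) P :=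
    ((integrable_const _).add ((hWi.sub (integrable_const _)).const_mul _)).add
      (((hint.const_mul _).const_mul _).const_mul _)
  have hI : Integrable (fun ω => Real.exp (t * (W ω - m))) P := by
    refine hdom.mono' (by fun_prop) (Filter.Eventually.of_forall fun ω => ?_)
    rw [Real.norm_of_nonneg (Real.exp_pos _).le]
    exact hle ω
  refine ⟨hI, ?_⟩
  have hval : ∫ ω, (1 + t * (W ω - m) +
      t ^ 2 * (8 / s ^ 2 * (Real.exp D * Real.exp (s * W ω)))) ∂P
      = 1 + t ^ 2 * (8 / s ^ 2 * (Real.exp D * ∫ ω, Real.exp (s * W ω) ∂P)) := by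
    have i1 : Integrable (fun ω => t * (W ω - m)) P := (hWi.sub (integrable_const _)).const_mul _
    have i2 : Integrable (fun ω => 1 + t * (W ω - m)) P := (integrable_const _).add i1
    have i3 : Integrable (fun ω => t ^ 2 * (8 / s ^ 2 * (Real.exp D * Real.exp (s * W ω)))) P :=
      ((hint.const_mul _).const_mul _).const_mul _
    rw [integral_add i2 i3, integral_add (integrable_const _) i1, integral_const_mul,
      integral_sub hWi (integrable_const _), integral_const_mul, integral_const_mul,
      integral_const_mul]
    simp [hm]
  calc mgf (fun ω => W ω - m) P t
      ≤ ∫ ω, (1 + t * (W ω - m) +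
        t ^ 2 * (8 / s ^ 2 * (Real.exp D * Real.exp (s * W ω)))) ∂P := integral_mono hI hdom hle
    _ = 1 + t ^ 2 * (8 / s ^ 2 * (Real.exp D * ∫ ω, Real.exp (s * W ω) ∂P)) := hval
    _ ≤ 1 + t ^ 2 * (8 / s ^ 2 * (Real.exp D * D)) := by gcongr
    _ = 8 / s ^ 2 * (Real.exp D * D) * t ^ 2 + 1 := by ring
    _ ≤ _ := Real.add_one_le_exp _

/-- Two-sided Chernoff bound at the exponents `± t` for independent variables whose moment
generating functions are at most `exp (C t²)` there. -/
theorem measureReal_le_abs_sum {m : ℕ} {X : Fin m → Ω → ℝ} (hX : ∀ j, Measurable (X j))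
    (hind : iIndepFun X P) {C K t : ℝ} (ht : 0 ≤ t)
    (hmgf : ∀ r : ℝ, |r| ≤ t → ∀ j, Integrable (fun ω => Real.exp (r * X j ω)) P ∧
      mgf (X j) P r ≤ Real.exp (C * r ^ 2)) :
    P.real {ω | m * (K * t) ≤ |∑ j, X j ω|} ≤ 2 * Real.exp (-(K - C) * (m * t ^ 2)) := by
  have hsum : ∀ r : ℝ, |r| ≤ t → Integrable (fun ω => Real.exp (r * (∑ j, X j) ω)) P ∧
      mgf (∑ j, X j) P r ≤ Real.exp (m * (C * r ^ 2)) := by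
    intro r hr
    refine ⟨hind.integrable_exp_mul_sum hX fun j _ => (hmgf r hr j).1, ?_⟩
    rw [hind.mgf_sum hX]
    calc ∏ j, mgf (X j) P r ≤ ∏ _j : Fin m, Real.exp (C * r ^ 2) :=
          Finset.prod_le_prod (fun _ _ => mgf_nonneg) fun j _ => (hmgf r hr j).2
      _ = _ := by
        rw [Finset.prod_const, Finset.card_univ, Fintype.card_fin, ← Real.exp_nat_mul]
  have h1 := measure_ge_le_exp_mul_mgf (μ := P) (X := ∑ j, X j) (m * (K * t)) ht
    (hsum t (abs_of_nonneg ht).le).1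
  have h2 := measure_le_le_exp_mul_mgf (μ := P) (X := ∑ j, X j) (-(m * (K * t)))
    (neg_nonpos.2 ht) (hsum (-t) (by rw [abs_neg, abs_of_nonneg ht])).1
  have h1' := h1.trans (mul_le_mul_of_nonneg_left (hsum t (abs_of_nonneg ht).le).2
    (Real.exp_pos _).le)
  have h2' := h2.trans (mul_le_mul_of_nonneg_left
    (hsum (-t) (by rw [abs_neg, abs_of_nonneg ht])).2 (Real.exp_pos _).le)
  rw [← Real.exp_add] at h1' h2'
  have e1 : -t * (m * (K * t)) + m * (C * t ^ 2) = -(K - C) * (m * t ^ 2) := by ring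
  have e2 : -(-t) * -(m * (K * t)) + m * (C * (-t) ^ 2) = -(K - C) * (m * t ^ 2) := by ring
  rw [e1] at h1'
  rw [e2] at h2'
  have hsub : {ω | m * (K * t) ≤ |∑ j, X j ω|} ⊆
      {ω | m * (K * t) ≤ (∑ j, X j) ω} ∪ {ω | (∑ j, X j) ω ≤ -(m * (K * t))} := by
    intro ω hω
    simp only [Set.mem_ofPred_eq, Set.mem_union, Finset.sum_apply] at hω ⊢
    rcases le_abs.1 hω with h | h
    · exact Or.inl h
    · exact Or.inr (by linarith)
  calc _ ≤ P.real ({ω | m * (K * t) ≤ (∑ j, X j) ω} ∪ {ω | (∑ j, X j) ω ≤ -(m * (K * t))}) :=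
        measureReal_mono hsub
    _ ≤ _ := (measureReal_union_le _ _).trans (by linarith)

end Concentration

/-! ### Gaussian moments and the expectation of the moment matrix -/

section GaussianMoments

variable {E : Type*} [NormedAddCommGroup E] [InnerProductSpace ℝ E] [FiniteDimensional ℝ E]
  [MeasurableSpace E] [BorelSpace E]

theorem integral_inner_stdGaussian (u : E) : ∫ x, ⟪x, u⟫ ∂(stdGaussian E) = 0 := by
  have := integral_strongDual_stdGaussian (innerSL ℝ u)
  simpa only [innerSL_apply_apply, real_inner_comm] using this

theorem memLp_inner_stdGaussian (u : E) (q : ENNReal) (hq : q ≠ ⊤) :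
    MemLp (fun x => ⟪x, u⟫) q (stdGaussian E) := by
  have := IsGaussian.memLp_dual (stdGaussian E) (innerSL ℝ u) q hq
  refine this.ae_eq (Filter.Eventually.of_forall fun x => ?_)
  simp only [innerSL_apply_apply, real_inner_comm]

theorem integral_inner_sq_stdGaussian (u : E) :
    ∫ x, ⟪x, u⟫ ^ 2 ∂(stdGaussian E) = ‖u‖ ^ 2 := by
  rw [← variance_of_integral_eq_zero (memLp_inner_stdGaussian u 2 (by simp)).aemeasurable
    (integral_inner_stdGaussian u)]
  have := variance_dual_stdGaussian (innerSL ℝ u)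
  rw [innerSL_apply_norm] at this
  rw [← this]
  congr 1
  ext x
  simp only [innerSL_apply_apply, real_inner_comm]

theorem map_inner_stdGaussian (u : E) :
    (stdGaussian E).map (fun x => ⟪x, u⟫) = gaussianReal 0 (Real.toNNReal (‖u‖ ^ 2)) := by
  have h := IsGaussian.map_eq_gaussianReal (μ := stdGaussian E) (innerSL ℝ u)
  rw [integral_strongDual_stdGaussian, variance_dual_stdGaussian, innerSL_apply_norm] at h
  rw [← h]
  congr 1
  ext x
  simp only [innerSL_apply_apply, real_inner_comm]

theorem indepFun_inner_stdGaussian {v w : E} (h : ⟪v, w⟫ = 0) :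
    IndepFun (fun x => ⟪x, v⟫) (fun x => ⟪x, w⟫) (stdGaussian E) := by
  have hlaw := (IsGaussian.hasGaussianLaw_id (μ := stdGaussian E)).map_fun
    ((innerSL ℝ v).prod (innerSL ℝ w))
  simp only [id, ContinuousLinearMap.prod_apply, innerSL_apply_apply] at hlaw
  simp only [real_inner_comm]
  refine hlaw.indepFun_of_covariance_eq_zero ?_
  rw [← covarianceBilin_apply_eq_cov IsGaussian.memLp_two_id, covarianceBilin_stdGaussian]
  exact h

variable {f : ℝ → ℝ} {β : E}

theorem mu_eq_integral_stdGaussian (hβ : ‖β‖ = 1) (hf : Measurable f) (k : ℕ) :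
    mu f k = ∫ x, f ⟪x, β⟫ * ⟪x, β⟫ ^ k ∂(stdGaussian E) := by
  have h := map_inner_stdGaussian β
  rw [hβ, one_pow, Real.toNNReal_one] at h
  rw [mu, ← h, integral_map (by fun_prop) (by fun_prop)]

theorem integrable_link_mul (hf : Measurable f) (hf1 : ∀ z, |f z| ≤ 1) {g : E → ℝ}
    (hg : Integrable g (stdGaussian E)) :
    Integrable (fun x => f ⟪x, β⟫ * g x) (stdGaussian E) :=
  hg.bdd_mul (c := 1) (hf.comp (by fun_prop)).aestronglyMeasurable (Filter.Eventually.of_forall fun x => hf1 _)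

theorem integral_link_mul_inner (hβ : ‖β‖ = 1) (hf : Measurable f) (hf1 : ∀ z, |f z| ≤ 1) (u : E) :
    ∫ x, f ⟪x, β⟫ * ⟪x, u⟫ ∂(stdGaussian E) = ⟪u, β⟫ * mu f 1 := by
  set a := ⟪u, β⟫ with ha
  set w := u - a • β with hw
  have hβw : ⟪β, w⟫ = 0 := by
    rw [hw, inner_sub_right, real_inner_smul_right, real_inner_self_eq_norm_sq, hβ,
      real_inner_comm, ha]
    ring
  have hind := indepFun_inner_stdGaussian hβw
  have hi := fun v => integrable_link_mul (β := β) hf hf1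
    ((memLp_inner_stdGaussian v 1 (by simp)).integrable le_rfl)
  have h1 : ∫ x, f ⟪x, β⟫ * ⟪x, w⟫ ∂(stdGaussian E) = 0 := by
    have := hind.integral_fun_comp_mul_comp (f := f) (g := id) (by fun_prop) (by fun_prop)
      hf.aestronglyMeasurable aestronglyMeasurable_id
    simp only [id] at this
    rw [this, integral_inner_stdGaussian, mul_zero]
  have e : ∀ x, f ⟪x, β⟫ * ⟪x, u⟫ = a * (f ⟪x, β⟫ * ⟪x, β⟫) + f ⟪x, β⟫ * ⟪x, w⟫ := by
    intro x
    rw [hw, inner_sub_right, real_inner_smul_right]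
    ring
  simp_rw [e]
  rw [integral_add ((hi β).const_mul a) (hi w), h1, add_zero, integral_const_mul,
    mu_eq_integral_stdGaussian hβ hf]
  simp

theorem integral_link_mul_inner_sq (hβ : ‖β‖ = 1) (hf : Measurable f) (hf1 : ∀ z, |f z| ≤ 1)
    (u : E) :
    ∫ x, f ⟪x, β⟫ * ⟪x, u⟫ ^ 2 ∂(stdGaussian E)
      = ⟪u, β⟫ ^ 2 * mu f 2 + (‖u‖ ^ 2 - ⟪u, β⟫ ^ 2) * mu f 0 := by
  set a := ⟪u, β⟫ with ha
  set w := u - a • β with hw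
  have hβw : ⟪β, w⟫ = 0 := by
    rw [hw, inner_sub_right, real_inner_smul_right, real_inner_self_eq_norm_sq, hβ,
      real_inner_comm, ha]
    ring
  have hnw : ‖w‖ ^ 2 = ‖u‖ ^ 2 - a ^ 2 := by
    rw [hw, norm_sub_sq_real, real_inner_smul_right, norm_smul, hβ, Real.norm_eq_abs, mul_one,
      sq_abs, ← ha]
    ring
  have hind := indepFun_inner_stdGaussian hβw
  have hL2 := fun v : E => memLp_inner_stdGaussian v 2 (by simp)
  have i1 : Integrable (fun x => f ⟪x, β⟫ * ⟪x, β⟫ ^ 2) (stdGaussian E) :=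
    integrable_link_mul hf hf1 (hL2 β).integrable_sq
  have i2 : Integrable (fun x => f ⟪x, β⟫ * (⟪x, β⟫ * ⟪x, w⟫)) (stdGaussian E) :=
    integrable_link_mul hf hf1 ((hL2 β).integrable_mul (hL2 w))
  have i3 : Integrable (fun x => f ⟪x, β⟫ * ⟪x, w⟫ ^ 2) (stdGaussian E) :=
    integrable_link_mul hf hf1 (hL2 w).integrable_sq
  have h2 : ∫ x, f ⟪x, β⟫ * (⟪x, β⟫ * ⟪x, w⟫) ∂(stdGaussian E) = 0 := by
    have := hind.integral_fun_comp_mul_comp (f := fun z => f z * z) (g := id) (by fun_prop)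
      (by fun_prop) (by fun_prop) aestronglyMeasurable_id
    simp only [id, mul_assoc] at this
    rw [this, integral_inner_stdGaussian, mul_zero]
  have h3 : ∫ x, f ⟪x, β⟫ * ⟪x, w⟫ ^ 2 ∂(stdGaussian E) = mu f 0 * ‖w‖ ^ 2 := by
    have := hind.integral_fun_comp_mul_comp (f := f) (g := fun z => z ^ 2) (by fun_prop)
      (by fun_prop) (by fun_prop) (by fun_prop)
    rw [this, integral_inner_sq_stdGaussian, mu_eq_integral_stdGaussian hβ hf]
    simp
  have e : ∀ x, f ⟪x, β⟫ * ⟪x, u⟫ ^ 2 = a ^ 2 * (f ⟪x, β⟫ * ⟪x, β⟫ ^ 2)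
      + (2 * a) * (f ⟪x, β⟫ * (⟪x, β⟫ * ⟪x, w⟫)) + f ⟪x, β⟫ * ⟪x, w⟫ ^ 2 := by
    intro x
    rw [hw, inner_sub_right, real_inner_smul_right]
    ring
  simp_rw [e]
  have i12 : Integrable (fun x => a ^ 2 * (f ⟪x, β⟫ * ⟪x, β⟫ ^ 2)
      + (2 * a) * (f ⟪x, β⟫ * (⟪x, β⟫ * ⟪x, w⟫))) (stdGaussian E) :=
    (i1.const_mul _).add (i2.const_mul _)
  rw [integral_add i12 i3,
    integral_add (i1.const_mul _) (i2.const_mul _), integral_const_mul, integral_const_mul, h2, h3,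
    hnw, mu_eq_integral_stdGaussian hβ hf 2]
  ring

/-- The exponential moment `𝔼[exp (Z² / 4)]` of a standard Gaussian variable `Z`. -/
def gaussExpSq : ℝ := ∫ z, Real.exp (z ^ 2 / 4) ∂(gaussianReal 0 1)

theorem integrable_exp_sq_gaussianReal :
    Integrable (fun z => Real.exp (z ^ 2 / 4)) (gaussianReal 0 1) := by
  rw [gaussianReal_of_var_ne_zero _ one_ne_zero]
  refine (integrable_withDensity_iff_integrable_smul' (measurable_gaussianPDF 0 1)
    (Filter.Eventually.of_forall fun _ => gaussianPDF_lt_top)).2 ?_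
  have h := (integrable_exp_neg_mul_sq (by norm_num : (0 : ℝ) < 1 / 4)).const_mul
    (√(2 * Real.pi))⁻¹
  refine h.congr (Filter.Eventually.of_forall fun z => ?_)
  simp only [toReal_gaussianPDF, gaussianPDFReal, smul_eq_mul, NNReal.coe_one, mul_one, sub_zero]
  rw [mul_assoc, ← Real.exp_add]
  ring_nf

theorem integrable_exp_inner_sq {u : E} (hu : ‖u‖ ≤ 1) :
    Integrable (fun x => Real.exp (⟪x, u⟫ ^ 2 / 4)) (stdGaussian E) ∧
      ∫ x, Real.exp (⟪x, u⟫ ^ 2 / 4) ∂(stdGaussian E) ≤ gaussExpSq := by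
  have hmap : (stdGaussian E).map (fun x => ⟪x, u⟫) = (gaussianReal 0 1).map (‖u‖ * ·) := by
    rw [map_inner_stdGaussian, gaussianReal_map_const_mul]
    congr 1
    · simp
    · ext
      simp
  have hle : ∀ z : ℝ, Real.exp ((‖u‖ * z) ^ 2 / 4) ≤ Real.exp (z ^ 2 / 4) := by
    intro z
    refine Real.exp_le_exp.2 ?_
    rw [mul_pow]
    have : ‖u‖ ^ 2 ≤ 1 := pow_le_one₀ (norm_nonneg _) hu
    nlinarith [sq_nonneg z]
  have hi : Integrable (fun z : ℝ => Real.exp ((‖u‖ * z) ^ 2 / 4)) (gaussianReal 0 1) :=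
    integrable_exp_sq_gaussianReal.mono' (by fun_prop) (Filter.Eventually.of_forall fun z => by
      rw [Real.norm_of_nonneg (Real.exp_pos _).le]
      exact hle z)
  have h1 : Integrable (fun z : ℝ => Real.exp (z ^ 2 / 4))
      ((stdGaussian E).map (fun x => ⟪x, u⟫)) := by
    rw [hmap]
    exact (integrable_map_measure (by fun_prop) (by fun_prop)).2 hi
  refine ⟨(integrable_map_measure (f := fun x : E => ⟪x, u⟫)
    (g := fun z : ℝ => Real.exp (z ^ 2 / 4)) (by fun_prop) (by fun_prop)).1 h1, ?_⟩
  rw [← integral_map (φ := fun x : E => ⟪x, u⟫) (f := fun z : ℝ => Real.exp (z ^ 2 / 4))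
    (by fun_prop) (by fun_prop), hmap, integral_map (by fun_prop) (by fun_prop)]
  exact integral_mono hi integrable_exp_sq_gaussianReal hle

end GaussianMoments

section Sample

variable {Ω : Type*} [MeasurableSpace Ω] {P : Measure Ω} [IsProbabilityMeasure P]

/-- The identity behind the moment matrix: for independent copies `(Y, G)`, `(Y', G')` with
`Y = ± 1`, one has `(Y' - Y)² = 2 (1 - Y Y')`, and all moments factor. -/
theorem integral_sq_sub_mul_sq_sub {Y G Y' G' : Ω → ℝ} {m₀ m₁ m₂ s : ℝ}
    (hY : Measurable Y) (hY' : Measurable Y')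
    (hind : IndepFun (fun ω => (Y ω, G ω)) (fun ω => (Y' ω, G' ω)) P)
    (hbin : ∀ᵐ ω ∂P, Y ω = -1 ∨ Y ω = 1) (hbin' : ∀ᵐ ω ∂P, Y' ω = -1 ∨ Y' ω = 1)
    (hL : MemLp G 2 P) (hL' : MemLp G' 2 P)
    (h0 : ∫ ω, Y ω ∂P = m₀) (h1 : ∫ ω, Y ω * G ω ∂P = m₁) (h2 : ∫ ω, Y ω * G ω ^ 2 ∂P = m₂)
    (h0' : ∫ ω, Y' ω ∂P = m₀) (h1' : ∫ ω, Y' ω * G' ω ∂P = m₁)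
    (h2' : ∫ ω, Y' ω * G' ω ^ 2 ∂P = m₂)
    (hg : ∫ ω, G ω ∂P = 0) (hs : ∫ ω, G ω ^ 2 ∂P = s) (hs' : ∫ ω, G' ω ^ 2 ∂P = s) :
    ∫ ω, (Y' ω - Y ω) ^ 2 * (G' ω - G ω) ^ 2 ∂P = 4 * (s - m₀ * m₂ + m₁ ^ 2) := by
  have hbd : ∀ᵐ ω ∂P, ‖Y ω‖ ≤ 1 := hbin.mono fun ω h => by rcases h with h | h <;> rw [h] <;> simp
  have hbd' : ∀ᵐ ω ∂P, ‖Y' ω‖ ≤ 1 :=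
    hbin'.mono fun ω h => by rcases h with h | h <;> rw [h] <;> simp
  have iY : Integrable Y P := Integrable.of_bound hY.aestronglyMeasurable 1 hbd
  have iY' : Integrable Y' P := Integrable.of_bound hY'.aestronglyMeasurable 1 hbd'
  have iG : Integrable G P := hL.integrable one_le_two
  have iG' : Integrable G' P := hL'.integrable one_le_two
  have iYG : Integrable (fun ω => Y ω * G ω) P := iG.bdd_mul hY.aestronglyMeasurable hbd
  have iYG' : Integrable (fun ω => Y' ω * G' ω) P := iG'.bdd_mul hY'.aestronglyMeasurable hbd'
  have iYG2 : Integrable (fun ω => Y ω * G ω ^ 2) P :=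
    hL.integrable_sq.bdd_mul hY.aestronglyMeasurable hbd
  have iYG2' : Integrable (fun ω => Y' ω * G' ω ^ 2) P :=
    hL'.integrable_sq.bdd_mul hY'.aestronglyMeasurable hbd'
  have key : ∀ (φ ψ : ℝ × ℝ → ℝ), Measurable φ → Measurable ψ →
      Integrable (fun ω => φ (Y ω, G ω)) P → Integrable (fun ω => ψ (Y' ω, G' ω)) P →
      Integrable (fun ω => φ (Y ω, G ω) * ψ (Y' ω, G' ω)) P ∧
      ∫ ω, φ (Y ω, G ω) * ψ (Y' ω, G' ω) ∂P
        = (∫ ω, φ (Y ω, G ω) ∂P) * ∫ ω, ψ (Y' ω, G' ω) ∂P := by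
    intro φ ψ hφ hψ i i'
    have hi := hind.comp hφ hψ
    exact ⟨hi.integrable_mul i i',
      hi.integral_fun_mul_eq_mul_integral i.aestronglyMeasurable i'.aestronglyMeasurable⟩
  obtain ⟨j1, e1⟩ := key (fun q => q.2) (fun q => q.2) (by fun_prop) (by fun_prop) iG iG'
  obtain ⟨j2, e2⟩ := key (fun q => q.1) (fun q => q.1 * q.2 ^ 2) (by fun_prop) (by fun_prop) iY
    iYG2'
  obtain ⟨j3, e3⟩ := key (fun q => q.1 * q.2) (fun q => q.1 * q.2) (by fun_prop) (by fun_prop) iYG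
    iYG'
  obtain ⟨j4, e4⟩ := key (fun q => q.1 * q.2 ^ 2) (fun q => q.1) (by fun_prop) (by fun_prop) iYG2
    iY'
  simp only at j1 j2 j3 j4 e1 e2 e3 e4
  have hae : (fun ω => (Y' ω - Y ω) ^ 2 * (G' ω - G ω) ^ 2) =ᵐ[P] fun ω =>
      2 * G' ω ^ 2 + (-4) * (G ω * G' ω) + 2 * G ω ^ 2 + (-2) * (Y ω * (Y' ω * G' ω ^ 2))
        + 4 * (Y ω * G ω * (Y' ω * G' ω)) + (-2) * (Y ω * G ω ^ 2 * Y' ω) := by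
    filter_upwards [hbin, hbin'] with ω h h'
    rcases h with h | h <;> rcases h' with h' | h' <;> rw [h, h'] <;> ring
  have i1 := hL'.integrable_sq.const_mul 2
  have i2 := i1.add (j1.const_mul (-4))
  have i3 := i2.add (hL.integrable_sq.const_mul 2)
  have i4 := i3.add (j2.const_mul (-2))
  have i5 := i4.add (j3.const_mul 4)
  rw [integral_congr_ae hae]
  have s5 := integral_add i5 (j4.const_mul (-2))
  have s4 := integral_add i4 (j3.const_mul 4)
  have s3 := integral_add i3 (j2.const_mul (-2))
  have s2 := integral_add i2 (hL.integrable_sq.const_mul 2)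
  have s1 := integral_add i1 (j1.const_mul (-4))
  simp only [Pi.add_apply, integral_const_mul] at s1 s2 s3 s4 s5
  rw [s5, s4, s3, s2, s1, e1, e2, e3, e4, h0, h1, h2, h0', h1', h2', hg, hs, hs']
  ring

variable {f : ℝ → ℝ} {p n : ℕ} {β : EuclideanSpace ℝ (Fin p)} {y : Fin n → Ω → ℝ}
  {x : Fin n → Ω → EuclideanSpace ℝ (Fin p)}

/-- Conditioning on `X` replaces `Y` by the link function. -/
theorem IsSample.integral_mul_comp (h : IsSample P f β y x) (i : Fin n)
    {g : EuclideanSpace ℝ (Fin p) → ℝ} (hg : Measurable g)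
    (hgi : Integrable g (stdGaussian (EuclideanSpace ℝ (Fin p)))) (hf : Measurable f)
    (hf1 : ∀ z, |f z| ≤ 1) :
    ∫ ω, y i ω * g (x i ω) ∂P = ∫ v, f ⟪v, β⟫ * g v ∂(stdGaussian (EuclideanSpace ℝ (Fin p))) := by
  have hx := h.measurable_x i
  have hpres : MeasurePreserving (x i) P (stdGaussian _) := ⟨hx, h.law_x i⟩
  have hgx : Integrable (fun ω => g (x i ω)) P := hpres.integrable_comp_of_integrable hgi
  set I : Ω → ℝ := Set.indicator {ω | y i ω = 1} (fun _ => (1 : ℝ)) with hI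
  have hms : MeasurableSet {ω | y i ω = 1} := h.measurable_y i (measurableSet_singleton 1)
  have hII : Integrable I P := (integrable_const (1 : ℝ)).indicator hms
  have hIg : Integrable (fun ω => I ω * g (x i ω)) P := by
    refine hgx.bdd_mul (c := 1) hII.aestronglyMeasurable (Filter.Eventually.of_forall fun ω => ?_)
    rw [hI, Set.indicator_apply]
    split_ifs <;> simp
  have hm : MeasurableSpace.comap (x i) inferInstance ≤ (inferInstance : MeasurableSpace Ω) :=
    hx.comap_le
  have hgm : StronglyMeasurable[MeasurableSpace.comap (x i) inferInstance]
      (fun ω => g (x i ω)) :=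
    (hg.comp (comap_measurable (x i))).stronglyMeasurable
  have hpull := condExp_mul_of_stronglyMeasurable_right hgm hIg hII
  have h1 : ∫ ω, I ω * g (x i ω) ∂P = ∫ ω, (f ⟪x i ω, β⟫ / 2 + 1 / 2) * g (x i ω) ∂P := by
    rw [← integral_condExp hm]
    refine integral_congr_ae ?_
    filter_upwards [hpull, h.cond_y i] with ω h1 h2
    have : (fun ω => I ω * g (x i ω)) = I * fun ω => g (x i ω) := rfl
    rw [this, h1, Pi.mul_apply, h2]
  have hfg : Integrable (fun ω => f ⟪x i ω, β⟫ * g (x i ω)) P :=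
    hpres.integrable_comp_of_integrable (integrable_link_mul hf hf1 hgi)
  have h2 : ∫ ω, f ⟪x i ω, β⟫ * g (x i ω) ∂P
      = ∫ v, f ⟪v, β⟫ * g v ∂(stdGaussian (EuclideanSpace ℝ (Fin p))) := by
    rw [← h.law_x i, integral_map hx.aemeasurable (by fun_prop)]
  rw [← h2]
  have hy : (fun ω => y i ω * g (x i ω)) =ᵐ[P] fun ω => 2 * (I ω * g (x i ω)) - g (x i ω) := by
    filter_upwards [h.binary i] with ω hω
    rw [hI]
    rcases hω with hω | hω
    · rw [Set.indicator_of_notMem (by simp [hω]; norm_num), hω]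
      ring
    · rw [Set.indicator_of_mem (show ω ∈ {ω | y i ω = 1} from hω), hω]
      ring
  rw [integral_congr_ae hy, integral_sub (hIg.const_mul 2) hgx, integral_const_mul, h1,
    ← integral_const_mul, ← integral_sub _ hgx]
  · refine integral_congr_ae (Filter.Eventually.of_forall fun ω => ?_)
    ring
  · have : Integrable (fun ω => f ⟪x i ω, β⟫ * g (x i ω) + g (x i ω)) P := hfg.add hgx
    refine this.congr (Filter.Eventually.of_forall fun ω => ?_)
    ring

theorem IsSample.integral_pair (h : IsSample P f β y x) {i k : Fin n} (hik : i ≠ k)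
    (hβ : ‖β‖ = 1) (hf : Measurable f) (hf1 : ∀ z, |f z| ≤ 1) (u : EuclideanSpace ℝ (Fin p)) :
    ∫ ω, (y k ω - y i ω) ^ 2 * ⟪x k ω - x i ω, u⟫ ^ 2 ∂P
      = 4 * (1 - mu f 0 ^ 2) * ‖u‖ ^ 2 + 4 * phi f * ⟪u, β⟫ ^ 2 := by
  have hL2 := memLp_inner_stdGaussian u 2 (by simp)
  have hpres : ∀ i, MeasurePreserving (x i) P (stdGaussian _) :=
    fun i => ⟨h.measurable_x i, h.law_x i⟩
  have hxm := h.measurable_x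
  have hL : ∀ i, MemLp (fun ω => ⟪x i ω, u⟫) 2 P :=
    fun i => hL2.comp_measurePreserving (hpres i)
  have hind : IndepFun (fun ω => (y i ω, ⟪x i ω, u⟫)) (fun ω => (y k ω, ⟪x k ω, u⟫)) P :=
    (h.indep.indepFun hik).comp (φ := fun q => (q.1, ⟪q.2, u⟫)) (ψ := fun q => (q.1, ⟪q.2, u⟫))
      (by fun_prop) (by fun_prop)
  have h0 : ∀ i, ∫ ω, y i ω ∂P = mu f 0 := by
    intro i
    have := h.integral_mul_comp i (g := fun _ => 1) (by fun_prop) (integrable_const _) hf hf1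
    rw [mu_eq_integral_stdGaussian hβ hf]
    simpa using this
  have h1 : ∀ i, ∫ ω, y i ω * ⟪x i ω, u⟫ ∂P = ⟪u, β⟫ * mu f 1 := fun i => by
    rw [← integral_link_mul_inner hβ hf hf1 u]
    exact h.integral_mul_comp i (g := fun v => ⟪v, u⟫) (by fun_prop) (hL2.integrable one_le_two)
      hf hf1
  have h2 : ∀ i, ∫ ω, y i ω * ⟪x i ω, u⟫ ^ 2 ∂P
      = ⟪u, β⟫ ^ 2 * mu f 2 + (‖u‖ ^ 2 - ⟪u, β⟫ ^ 2) * mu f 0 := fun i => by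
    rw [← integral_link_mul_inner_sq hβ hf hf1 u]
    exact h.integral_mul_comp i (g := fun v => ⟪v, u⟫ ^ 2) (by fun_prop) hL2.integrable_sq hf hf1
  have hg : ∫ ω, ⟪x i ω, u⟫ ∂P = 0 := by
    rw [← integral_inner_stdGaussian u, ← h.law_x i,
      integral_map (hxm i).aemeasurable (by fun_prop)]
  have hs : ∀ i, ∫ ω, ⟪x i ω, u⟫ ^ 2 ∂P = ‖u‖ ^ 2 := fun i => by
    rw [← integral_inner_sq_stdGaussian u, ← h.law_x i,
      integral_map (hxm i).aemeasurable (by fun_prop)]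
  have := integral_sq_sub_mul_sq_sub (h.measurable_y i) (h.measurable_y k)
    hind (h.binary i) (h.binary k) (hL i) (hL k) (h0 i) (h1 i) (h2 i) (h0 k) (h1 k)
    (h2 k) hg (hs i) (hs k)
  simp_rw [inner_sub_left]
  rw [this, phi]
  ring

end Sample

/-! ### Concentration of the moment matrix -/

section MomentMatrix

variable {p n : ℕ}

/-- The quadratic form of the `j`-th rank-one summand of the moment matrix. -/
def pairForm (y : Fin n → ℝ) (x : Fin n → EuclideanSpace ℝ (Fin p)) (u : EuclideanSpace ℝ (Fin p))
    (j : Fin (n / 2)) : ℝ :=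
  (y ⟨2 * j + 1, by omega⟩ - y ⟨2 * j, by omega⟩) ^ 2 *
    ⟪x ⟨2 * j + 1, by omega⟩ - x ⟨2 * j, by omega⟩, u⟫ ^ 2

theorem isSymmetric_momentMatrix (y : Fin n → ℝ) (x : Fin n → EuclideanSpace ℝ (Fin p)) :
    (momentMatrix y x).toEuclideanLin.IsSymmetric := by
  refine Matrix.isSymmetric_toEuclideanLin_iff.2 ?_
  have hv : ∀ v : Fin p → ℝ, (Matrix.vecMulVec v v).IsHermitian := by
    intro v
    ext a b
    simp [Matrix.vecMulVec_apply, mul_comm]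
  unfold momentMatrix Matrix.IsHermitian
  rw [Matrix.conjTranspose_smul, Matrix.conjTranspose_sum]
  simp only [Matrix.conjTranspose_smul, (hv _).eq, star_trivial]

theorem inner_momentMatrix (y : Fin n → ℝ) (x : Fin n → EuclideanSpace ℝ (Fin p))
    (u : EuclideanSpace ℝ (Fin p)) :
    ⟪(momentMatrix y x).toEuclideanLin u, u⟫ = 2 / n * ∑ j, pairForm y x u j := by
  have hv : ∀ v : EuclideanSpace ℝ (Fin p),
      ⟪(Matrix.vecMulVec v.ofLp v.ofLp).toEuclideanLin u, u⟫ = ⟪v, u⟫ ^ 2 := by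
    intro v
    have e : (Matrix.vecMulVec v.ofLp v.ofLp).toEuclideanLin u = ⟪v, u⟫ • v := by
      ext a
      simp only [Matrix.toLpLin_apply, Matrix.vecMulVec_mulVec, PiLp.smul_apply, Pi.smul_apply,
        PiLp.inner_apply, RCLike.inner_apply, conj_trivial, dotProduct, MulOpposite.smul_eq_mul_unop,
        MulOpposite.unop_op, smul_eq_mul]
      rw [mul_comm]
      simp only [mul_comm]
    rw [e, real_inner_smul_left, sq]
  unfold momentMatrix pairForm
  simp only [map_smul, map_sum, LinearMap.smul_apply, LinearMap.sum_apply, real_inner_smul_left,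
    sum_inner, hv]

variable {Ω : Type*} [MeasurableSpace Ω] {P : Measure Ω} {f : ℝ → ℝ}
  {β : EuclideanSpace ℝ (Fin p)} {y : Fin n → Ω → ℝ} {x : Fin n → Ω → EuclideanSpace ℝ (Fin p)}

theorem IsSample.measurable_pairForm (h : IsSample P f β y x) (u : EuclideanSpace ℝ (Fin p))
    (j : Fin (n / 2)) : Measurable fun ω => pairForm (y · ω) (x · ω) u j := by
  have := h.measurable_x
  have := h.measurable_y
  unfold pairForm
  fun_prop

theorem IsSample.iIndepFun_pairForm (h : IsSample P f β y x) (u : EuclideanSpace ℝ (Fin p)) :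
    iIndepFun (fun j ω => pairForm (y · ω) (x · ω) u j) P := by
  have hlt : ∀ q : Fin (n / 2) × Fin 2, 2 * (q.1 : ℕ) + q.2 < n := fun q => by omega
  have hinj : Function.Injective
      (fun q : Fin (n / 2) × Fin 2 => (⟨2 * (q.1 : ℕ) + q.2, hlt q⟩ : Fin n)) := by
    rintro ⟨a, b⟩ ⟨c, d⟩ hq
    simp only [Fin.mk.injEq] at hq
    ext <;> simp only <;> omega
  have h1 := (h.indep.precomp hinj).curry
    (fun q => (h.measurable_y _).prodMk (h.measurable_x _))
  exact h1.comp (fun _ q => ((q 1).1 - (q 0).1) ^ 2 * ⟪(q 1).2 - (q 0).2, u⟫ ^ 2)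
    (fun _ => by fun_prop)

/-- The summands have a bounded exponential moment, since `W ≤ 8 (g² + g'²)` for the two Gaussian
projections `g`, `g'` of the pair. -/
theorem IsSample.exp_pairForm (h : IsSample P f β y x) {u : EuclideanSpace ℝ (Fin p)}
    (hu : ‖u‖ ≤ 1) (j : Fin (n / 2)) :
    Integrable (fun ω => Real.exp (1 / 64 * pairForm (y · ω) (x · ω) u j)) P ∧
      ∫ ω, Real.exp (1 / 64 * pairForm (y · ω) (x · ω) u j) ∂P ≤ gaussExpSq := by
  obtain ⟨hi, hle⟩ := integrable_exp_inner_sq hu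
  have hxm := h.measurable_x
  have hpres : ∀ i, MeasurePreserving (x i) P (stdGaussian _) :=
    fun i => ⟨h.measurable_x i, h.law_x i⟩
  have hI : ∀ i, Integrable (fun ω => Real.exp (⟪x i ω, u⟫ ^ 2 / 4)) P :=
    fun i => (hpres i).integrable_comp_of_integrable hi
  have hV : ∀ i, ∫ ω, Real.exp (⟪x i ω, u⟫ ^ 2 / 4) ∂P ≤ gaussExpSq := by
    intro i
    refine le_of_eq_of_le ?_ hle
    rw [← h.law_x i, integral_map (hxm i).aemeasurable (by fun_prop)]
  set i₁ : Fin n := ⟨2 * j + 1, by omega⟩ with hi₁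
  set i₀ : Fin n := ⟨2 * j, by omega⟩ with hi₀
  have hb : ∀ᵐ ω ∂P, Real.exp (1 / 64 * pairForm (y · ω) (x · ω) u j) ≤
      1 / 2 * Real.exp (⟪x i₁ ω, u⟫ ^ 2 / 4) + 1 / 2 * Real.exp (⟪x i₀ ω, u⟫ ^ 2 / 4) := by
    filter_upwards [h.binary i₁, h.binary i₀] with ω h1 h0
    have hy : (y i₁ ω - y i₀ ω) ^ 2 ≤ 4 := by
      rcases h1 with h1 | h1 <;> rcases h0 with h0 | h0 <;> rw [h1, h0] <;> norm_num
    have hW : 1 / 64 * pairForm (y · ω) (x · ω) u j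
        ≤ ⟪x i₁ ω, u⟫ ^ 2 / 8 + ⟪x i₀ ω, u⟫ ^ 2 / 8 := by
      have e : pairForm (y · ω) (x · ω) u j
          = (y i₁ ω - y i₀ ω) ^ 2 * (⟪x i₁ ω, u⟫ - ⟪x i₀ ω, u⟫) ^ 2 := by
        rw [← inner_sub_left]
        rfl
      rw [e]
      have := mul_le_mul_of_nonneg_right hy (sq_nonneg (⟪x i₁ ω, u⟫ - ⟪x i₀ ω, u⟫))
      nlinarith [sq_nonneg (⟪x i₁ ω, u⟫ + ⟪x i₀ ω, u⟫)]
    refine (Real.exp_le_exp.2 hW).trans ?_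
    have e : ∀ a : ℝ, Real.exp (a / 4) = Real.exp (a / 8) ^ 2 := fun a => by
      rw [← Real.exp_nat_mul]
      congr 1
      push_cast
      ring
    rw [Real.exp_add, e, e]
    nlinarith [sq_nonneg (Real.exp (⟪x i₁ ω, u⟫ ^ 2 / 8) - Real.exp (⟪x i₀ ω, u⟫ ^ 2 / 8))]
  have hdom := ((hI i₁).const_mul (1 / 2)).add ((hI i₀).const_mul (1 / 2))
  have hint : Integrable (fun ω => Real.exp (1 / 64 * pairForm (y · ω) (x · ω) u j)) P := by
    refine hdom.mono' ((h.measurable_pairForm u j).const_mul _).exp.aestronglyMeasurable ?_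
    filter_upwards [hb] with ω hω
    rw [Real.norm_of_nonneg (Real.exp_pos _).le]
    exact hω
  refine ⟨hint, (integral_mono_ae hint hdom hb).trans ?_⟩
  have e := integral_add ((hI i₁).const_mul (1 / 2)) ((hI i₀).const_mul (1 / 2))
  rw [integral_const_mul, integral_const_mul] at e
  refine (le_of_eq e).trans ?_
  linarith [hV i₁, hV i₀]

/-- The variance proxy in the sub-exponential bound for the summands of the moment matrix. -/
def varProxy : ℝ := 8 / (1 / 64) ^ 2 * (Real.exp gaussExpSq * gaussExpSq)

theorem varProxy_nonneg : 0 ≤ varProxy := by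
  have : 0 ≤ gaussExpSq := integral_nonneg fun z => (Real.exp_pos _).le
  unfold varProxy
  positivity

variable [IsProbabilityMeasure P]

/-- Deviation of the quadratic form of the moment matrix at a fixed vector. -/
theorem IsSample.measureReal_form_deviation_le (h : IsSample P f β y x) (hn : Even n)
    (hn0 : 0 < n) (hβ : ‖β‖ = 1) (hf : Measurable f) (hf1 : ∀ z, |f z| ≤ 1)
    {u : EuclideanSpace ℝ (Fin p)} (hu : ‖u‖ ≤ 1) {K t : ℝ} (ht0 : 0 ≤ t) (ht : t ≤ 1 / 128) :
    P.real {ω | K * t ≤ |⟪((momentMatrix (y · ω) (x · ω)).toEuclideanLin -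
        spiked (4 * (1 - mu f 0 ^ 2)) (4 * phi f) β) u, u⟫|} ≤
      2 * Real.exp (-(K - varProxy) * ((n / 2 : ℕ) * t ^ 2)) := by
  set m := n / 2 with hm
  have hnm : (n : ℝ) = 2 * m := by
    have : n = 2 * m := by
      obtain ⟨k, rfl⟩ := hn
      omega
    exact_mod_cast this
  have hm0 : (0 : ℝ) < m := by
    have : (0 : ℝ) < n := by exact_mod_cast hn0
    linarith
  set X : Fin m → Ω → ℝ := fun j ω => pairForm (y · ω) (x · ω) u j
    - ∫ ω', pairForm (y · ω') (x · ω') u j ∂P with hX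
  have hXm : ∀ j, Measurable (X j) := fun j => (h.measurable_pairForm u j).sub_const _
  have hXi : iIndepFun X P := (h.iIndepFun_pairForm u).comp
    (fun j z => z - ∫ ω', pairForm (y · ω') (x · ω') u j ∂P) (fun j => by fun_prop)
  have hmgf : ∀ r : ℝ, |r| ≤ t → ∀ j, Integrable (fun ω => Real.exp (r * X j ω)) P ∧
      mgf (X j) P r ≤ Real.exp (varProxy * r ^ 2) := by
    intro r hr j
    obtain ⟨h1, h2⟩ := h.exp_pairForm hu j
    exact mgf_centered_le (by norm_num) (h.measurable_pairForm u j)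
      (fun ω => mul_nonneg (sq_nonneg _) (sq_nonneg _)) h1 h2 (by linarith)
  refine le_trans (measureReal_mono fun ω hω => ?_) (measureReal_le_abs_sum hXm hXi ht0 hmgf)
  have hform : ⟪((momentMatrix (y · ω) (x · ω)).toEuclideanLin -
        spiked (4 * (1 - mu f 0 ^ 2)) (4 * phi f) β) u, u⟫ = (∑ j, X j ω) / m := by
    rw [LinearMap.sub_apply, inner_sub_left, inner_momentMatrix, spiked_apply, inner_add_left,
      real_inner_smul_left, real_inner_smul_left, real_inner_self_eq_norm_sq, hX,
      Finset.sum_sub_distrib]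
    have hmean : ∀ j : Fin m, ∫ ω', pairForm (y · ω') (x · ω') u j ∂P
        = 4 * (1 - mu f 0 ^ 2) * ‖u‖ ^ 2 + 4 * phi f * ⟪u, β⟫ ^ 2 := fun j =>
      h.integral_pair (by simp) hβ hf hf1 u
    simp_rw [hmean]
    rw [Finset.sum_const, Finset.card_univ, Fintype.card_fin, nsmul_eq_mul, hnm,
      real_inner_comm u β]
    field_simp
    ring
  have hω' : K * t ≤ |(∑ j, X j ω) / m| := by
    rw [← hform]
    exact hω
  rw [abs_div, abs_of_pos hm0, le_div_iff₀ hm0] at hω'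
  show m * (K * t) ≤ |∑ j, X j ω|
  linarith

/-- Concentration of the moment matrix in operator norm, by a union bound over a `1 / 2`-net of the
unit ball. -/
theorem IsSample.exists_concentration (h : IsSample P f β y x) (hn : Even n) (hn0 : 0 < n)
    (hβ : ‖β‖ = 1) (hf : Measurable f) (hf1 : ∀ z, |f z| ≤ 1)
    (hpn : √((p : ℝ) / (n / 2 : ℕ)) ≤ 1 / 128) :
    ∃ G : Set Ω, MeasurableSet G ∧ 1 - 2 * Real.exp (-p) ≤ P.real G ∧ ∀ ω ∈ G, ∀ z,
      ‖((momentMatrix (y · ω) (x · ω)).toEuclideanLin -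
        spiked (4 * (1 - mu f 0 ^ 2)) (4 * phi f) β) z‖ ≤
      4 * ((varProxy + 1 + Real.log 5) * √((p : ℝ) / (n / 2 : ℕ))) * ‖z‖ := by
  obtain ⟨N, hNcard, hN1, hN⟩ := exists_half_net (E := EuclideanSpace ℝ (Fin p))
  rw [finrank_euclideanSpace_fin] at hNcard
  set t := √((p : ℝ) / (n / 2 : ℕ)) with ht
  set K := varProxy + 1 + Real.log 5 with hK
  have hK0 : 0 ≤ K := by
    have := varProxy_nonneg
    have := Real.log_nonneg (by norm_num : (1 : ℝ) ≤ 5)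
    positivity
  have hm0 : (0 : ℝ) < (n / 2 : ℕ) := by
    obtain ⟨k, rfl⟩ := hn
    exact_mod_cast (by omega : 0 < (k + k) / 2)
  have hmt : (n / 2 : ℕ) * t ^ 2 = (p : ℝ) := by
    rw [ht, Real.sq_sqrt (by positivity), mul_div_cancel₀ _ hm0.ne']
  set A : Ω → EuclideanSpace ℝ (Fin p) →ₗ[ℝ] EuclideanSpace ℝ (Fin p) := fun ω =>
    (momentMatrix (y · ω) (x · ω)).toEuclideanLin
      - spiked (4 * (1 - mu f 0 ^ 2)) (4 * phi f) β with hA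
  have hmeas : ∀ u, Measurable fun ω => ⟪A ω u, u⟫ := by
    intro u
    have := h.measurable_pairForm u
    simp only [hA, LinearMap.sub_apply, inner_sub_left, inner_momentMatrix]
    fun_prop
  set B : Set Ω := ⋃ u ∈ N, {ω | K * t ≤ |⟪A ω u, u⟫|} with hB
  have hBm : MeasurableSet B := N.measurableSet_biUnion fun u _ =>
    measurableSet_le measurable_const (hmeas u).abs
  refine ⟨Bᶜ, hBm.compl, ?_, ?_⟩
  · have hPB : P.real B ≤ 2 * Real.exp (-p) := by
      calc P.real B ≤ ∑ u ∈ N, P.real {ω | K * t ≤ |⟪A ω u, u⟫|} :=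
            measureReal_biUnion_finset_le _ _
        _ ≤ ∑ u ∈ N, 2 * Real.exp (-(1 + Real.log 5) * p) := by
            refine Finset.sum_le_sum fun u hu => ?_
            have := h.measureReal_form_deviation_le hn hn0 hβ hf hf1 (hN1 u hu) (K := K)
              (Real.sqrt_nonneg _) hpn
            rw [hmt, show K - varProxy = 1 + Real.log 5 by rw [hK]; ring] at this
            exact this
        _ = N.card * (2 * Real.exp (-(1 + Real.log 5) * p)) := by
            rw [Finset.sum_const, nsmul_eq_mul]
        _ ≤ (5 : ℝ) ^ p * (2 * Real.exp (-(1 + Real.log 5) * p)) := by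
            gcongr
            exact_mod_cast hNcard
        _ = 2 * Real.exp (-p) := by
            rw [← Real.exp_log (by positivity : (0 : ℝ) < 5 ^ p), Real.log_pow, mul_left_comm,
              ← Real.exp_add]
            ring_nf
    rw [probReal_compl_eq_one_sub hBm]
    linarith
  · intro ω hω z
    refine norm_apply_le_of_net
      ((isSymmetric_momentMatrix _ _).sub (isSymmetric_spiked _ _ _)) (by positivity) hN ?_ z
    intro v hv
    by_contra! hcon
    exact hω (Set.mem_biUnion hv hcon.le)

end MomentMatrix

/-! ### Signal strength of the example models -/

section Models

theorem measureReal_gaussianReal_eq_setIntegral (s : Set ℝ) :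
    (gaussianReal 0 1).real s = ∫ z in s, gaussianPDFReal 0 1 z := by
  rw [measureReal_def, gaussianReal_apply_eq_integral _ one_ne_zero, ENNReal.toReal_ofReal]
  exact integral_nonneg fun z => gaussianPDFReal_nonneg 0 1 z

theorem gaussianPDFReal_le_of_abs_le {a b : ℝ} (h : |a| ≤ |b|) :
    gaussianPDFReal 0 1 b ≤ gaussianPDFReal 0 1 a := by
  simp only [gaussianPDFReal, NNReal.coe_one, sub_zero, mul_one]
  refine mul_le_mul_of_nonneg_left (Real.exp_le_exp.2 ?_) (by positivity)
  linarith [sq_le_sq.2 h]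

theorem mul_le_measureReal_Ioo {a b k : ℝ} (hab : a ≤ b)
    (hk : ∀ z ∈ Set.Ioo a b, k ≤ gaussianPDFReal 0 1 z) :
    (b - a) * k ≤ (gaussianReal 0 1).real (Set.Ioo a b) := by
  rw [measureReal_gaussianReal_eq_setIntegral]
  calc (b - a) * k = ∫ _z in Set.Ioo a b, k := by
        rw [setIntegral_const, Real.volume_real_Ioo_of_le hab, smul_eq_mul]
    _ ≤ _ := setIntegral_mono_on (by simp) (integrable_gaussianPDFReal 0 1).integrableOn
        measurableSet_Ioo hk

variable {f : ℝ → ℝ}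

theorem mu_zero_eq_zero_of_odd (hf : Measurable f) (hodd : ∀ z, z ≠ 0 → f (-z) = -f z) :
    mu f 0 = 0 := by
  have := nullSingletonClass_gaussianReal (μ := 0) (v := 1) one_ne_zero
  have hne : ∀ᵐ z ∂(gaussianReal 0 1), z ≠ 0 := by
    simp [ae_iff]
  have h1 : mu f 0 = ∫ z, f (-z) ∂(gaussianReal 0 1) := by
    have hmap := gaussianReal_map_neg (μ := 0) (v := 1)
    rw [neg_zero] at hmap
    unfold mu
    simp only [pow_zero, mul_one]
    nth_rewrite 1 [← hmap]
    rw [integral_map (by fun_prop) (by fun_prop)]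
  have h2 : ∫ z, f (-z) ∂(gaussianReal 0 1) = -mu f 0 := by
    rw [mu, ← integral_neg]
    refine integral_congr_ae (hne.mono fun z hz => ?_)
    simp [hodd z hz]
  linarith

theorem phi_of_mu_zero (h : mu f 0 = 0) : phi f = mu f 1 ^ 2 := by
  rw [phi, h]
  ring

theorem integrable_mul_pow_gaussianReal (hf : Measurable f) (hf1 : ∀ z, |f z| ≤ 1) (k : ℕ) :
    Integrable (fun z => f z * z ^ k) (gaussianReal 0 1) := by
  have h : Integrable (fun z : ℝ => z ^ k) (gaussianReal 0 1) := by
    rcases Nat.eq_zero_or_pos k with rfl | hk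
    · simp
    · exact ((memLp_id_gaussianReal' (k : ENNReal) (by simp)).integrable_norm_pow hk.ne').mono
        (by fun_prop) (by simp)
  exact h.bdd_mul (c := 1) hf.aestronglyMeasurable (Filter.Eventually.of_forall hf1)

theorem abs_mu_zero_le (hf1 : ∀ z, |f z| ≤ 1) : |mu f 0| ≤ 1 := by
  have := norm_integral_le_of_norm_le_const (μ := gaussianReal 0 1) (f := fun z => f z * z ^ 0)
    (C := 1) (Filter.Eventually.of_forall fun z => by simpa using hf1 z)
  simpa [mu] using this

/-! ### Flipped logistic regression -/

theorem flippedLogisticLink_eq (pe z : ℝ) :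
    flippedLogisticLink pe z = (1 - 2 * pe) * flippedLogisticLink 0 z := by
  unfold flippedLogisticLink
  have : Real.exp z + 1 ≠ 0 := by positivity
  have : 1 + Real.exp z ≠ 0 := by positivity
  field_simp
  ring

theorem measurable_flippedLogisticLink (pe : ℝ) : Measurable (flippedLogisticLink pe) := by
  unfold flippedLogisticLink
  fun_prop

theorem abs_flippedLogisticLink_le {pe : ℝ} (h0 : 0 ≤ pe) (h1 : pe < 1 / 2) (z : ℝ) :
    |flippedLogisticLink pe z| ≤ 1 := by
  have h2 : |flippedLogisticLink 0 z| ≤ 1 := by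
    have := Real.exp_pos z
    rw [flippedLogisticLink, mul_zero, zero_mul, add_zero, abs_div,
      abs_of_pos (by positivity : 0 < Real.exp z + 1), div_le_one (by positivity), abs_le]
    constructor <;> linarith
  rw [flippedLogisticLink_eq, abs_mul, abs_of_pos (by linarith)]
  nlinarith [abs_nonneg (flippedLogisticLink 0 z)]

theorem flippedLogisticLink_neg (pe z : ℝ) :
    flippedLogisticLink pe (-z) = -flippedLogisticLink pe z := by
  unfold flippedLogisticLink
  rw [Real.exp_neg]
  have := Real.exp_pos z
  field_simp
  ring

theorem mu_one_flippedLogisticLink_zero_pos : 0 < mu (flippedLogisticLink 0) 1 := by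
  have hpos : ∀ z ≠ 0, 0 < flippedLogisticLink 0 z * z := by
    intro z hz
    rw [flippedLogisticLink, mul_zero, zero_mul, add_zero, div_mul_eq_mul_div]
    refine div_pos ?_ (by positivity)
    rcases lt_or_gt_of_ne hz with h | h
    · exact mul_pos_of_neg_of_neg (by linarith [Real.exp_lt_one_iff.2 h]) h
    · exact mul_pos (by linarith [Real.one_lt_exp_iff.2 h]) h
  have := nullSingletonClass_gaussianReal (μ := 0) (v := 1) one_ne_zero
  refine (integral_pos_iff_support_of_nonneg (fun z => ?_) (integrable_mul_pow_gaussianReal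
    (measurable_flippedLogisticLink 0)
    (abs_flippedLogisticLink_le le_rfl (by norm_num)) 1)).2 ?_
  · rw [pow_one]
    rcases eq_or_ne z 0 with rfl | h
    · simp
    · exact (hpos z h).le
  · have hsub : ({0}ᶜ : Set ℝ) ⊆ Function.support fun z => flippedLogisticLink 0 z * z ^ 1 := by
      intro z hz
      rw [Function.mem_support, pow_one]
      exact (hpos z hz).ne'
    refine lt_of_lt_of_le ?_ (measure_mono hsub)
    rw [prob_compl_eq_one_sub (measurableSet_singleton 0), measure_singleton]
    simp

theorem phi_flippedLogisticLink (pe : ℝ) :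
    phi (flippedLogisticLink pe) = (1 - 2 * pe) ^ 2 * mu (flippedLogisticLink 0) 1 ^ 2 := by
  rw [phi_of_mu_zero (mu_zero_eq_zero_of_odd (measurable_flippedLogisticLink pe)
    fun z _ => flippedLogisticLink_neg pe z), ← mul_pow]
  congr 1
  unfold mu
  rw [← integral_const_mul]
  congr 1
  ext z
  rw [flippedLogisticLink_eq]
  ring

/-! ### Robust one-bit compressed sensing -/

theorem robustOneBitLink_eq (σ z : ℝ) :
    robustOneBitLink σ z = 2 * (gaussianReal 0 1).real {u | 0 < z + σ * u} - 1 := by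
  have hmap : gaussianReal z (Real.toNNReal (σ ^ 2))
      = (gaussianReal 0 1).map (fun u => z + σ * u) := by
    have h1 : (gaussianReal 0 1).map (σ * ·) = gaussianReal 0 (Real.toNNReal (σ ^ 2)) := by
      rw [gaussianReal_map_const_mul]
      congr 1
      · simp
      · ext
        simp [sq_nonneg]
    have h2 := gaussianReal_map_const_add (μ := 0) (v := Real.toNNReal (σ ^ 2)) z
    rw [← h1, Measure.map_map (by fun_prop) (by fun_prop), zero_add] at h2
    exact h2.symm
  rw [robustOneBitLink, hmap, map_measureReal_apply (by fun_prop) measurableSet_Ioi]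
  rfl

theorem measurable_robustOneBitLink (σ : ℝ) : Measurable (robustOneBitLink σ) := by
  refine Monotone.measurable fun a b hab => ?_
  rw [robustOneBitLink_eq, robustOneBitLink_eq]
  have : (gaussianReal 0 1).real {u | 0 < a + σ * u} ≤ (gaussianReal 0 1).real {u | 0 < b + σ * u} :=
    measureReal_mono fun u (hu : 0 < a + σ * u) =>
      show 0 < b + σ * u by linarith
  linarith

theorem abs_robustOneBitLink_le (σ z : ℝ) : |robustOneBitLink σ z| ≤ 1 := by
  rw [robustOneBitLink_eq, abs_le]
  have h1 := measureReal_nonneg (μ := gaussianReal 0 1) (s := {u | 0 < z + σ * u})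
  have h2 := measureReal_le_one (μ := gaussianReal 0 1) (s := {u | 0 < z + σ * u})
  constructor <;> linarith

theorem measureReal_gaussianReal_neg {s : Set ℝ} (hs : MeasurableSet s) :
    (gaussianReal 0 1).real {u | -u ∈ s} = (gaussianReal 0 1).real s := by
  have hmap := gaussianReal_map_neg (μ := 0) (v := 1)
  rw [neg_zero] at hmap
  nth_rewrite 2 [← hmap]
  rw [map_measureReal_apply (by fun_prop) hs]
  rfl

theorem robustOneBitLink_neg (σ : ℝ) {z : ℝ} (hz : z ≠ 0) :
    robustOneBitLink σ (-z) = -robustOneBitLink σ z := by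
  have := nullSingletonClass_gaussianReal (μ := 0) (v := 1) one_ne_zero
  have hm : MeasurableSet {u : ℝ | 0 < z + σ * u} := measurableSet_lt (by fun_prop) (by fun_prop)
  have h1 : (gaussianReal 0 1).real {u | 0 < -z + σ * u}
      = (gaussianReal 0 1).real {u | 0 < z + σ * u}ᶜ := by
    rw [← measureReal_gaussianReal_neg hm.compl]
    refine measureReal_congr ?_
    have hne : ∀ᵐ u ∂(gaussianReal 0 1), z ≠ σ * u := by
      have hsub : Set.Subsingleton {u : ℝ | z = σ * u} := by
        intro a ha b hb
        have ha' : z = σ * a := ha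
        have hb' : z = σ * b := hb
        have hσ : σ ≠ 0 := by
          rintro rfl
          exact hz (by simpa using ha')
        exact mul_left_cancel₀ hσ (ha'.symm.trans hb')
      simpa [ae_iff] using hsub.measure_zero (gaussianReal 0 1)
    filter_upwards [hne] with u hu
    refine propext ⟨fun h => ?_, fun h => ?_⟩
    · have h' : 0 < -z + σ * u := h
      show ¬ 0 < z + σ * -u
      linarith
    · have h' : ¬ 0 < z + σ * -u := h
      show 0 < -z + σ * u
      have : z ≤ σ * u := by linarith
      have := lt_of_le_of_ne this hu
      linarith
  rw [robustOneBitLink_eq, robustOneBitLink_eq, h1, probReal_compl_eq_one_sub hm]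
  ring

/-- For `z > 0` the link is `ℙ(σ |ε| < z)`, here with `ε` standard Gaussian, which is at least the
width of the interval times the density at its end. -/
theorem le_robustOneBitLink {σ z : ℝ} (hσ : 0 ≤ σ) (hz : 0 < z) :
    2 / max 1 σ * z * gaussianPDFReal 0 1 z ≤ robustOneBitLink σ z := by
  have hs1 : 1 ≤ max 1 σ := le_max_left _ _
  have hs : 0 < max 1 σ := by positivity
  have hmA : MeasurableSet {u : ℝ | 0 < z + σ * u} := measurableSet_lt (by fun_prop) (by fun_prop)
  have hmB : MeasurableSet {u : ℝ | 0 < z + σ * -u} := measurableSet_lt (by fun_prop) (by fun_prop)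
  have hB : (gaussianReal 0 1).real {u | 0 < z + σ * -u}
      = (gaussianReal 0 1).real {u | 0 < z + σ * u} := measureReal_gaussianReal_neg hmA
  have hU : {u : ℝ | 0 < z + σ * u} ∪ {u : ℝ | 0 < z + σ * -u} = Set.univ := by
    ext u
    simp only [Set.mem_union, Set.mem_ofPred_eq, Set.mem_univ, iff_true]
    by_contra! h
    linarith [h.1, h.2]
  have hsum := measureReal_union_add_inter (μ := gaussianReal 0 1)
    (s := {u : ℝ | 0 < z + σ * u}) hmB
  -- The sets `{0 < z + σ u}` and `{0 < z - σ u}` have equal mass and cover the line, so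
  -- `2 ℙ(0 < z + σ u) - 1` is the mass of their intersection.
  rw [hU, hB, probReal_univ] at hsum
  have hsub : Set.Ioo (-(z / max 1 σ)) (z / max 1 σ) ⊆
      {u : ℝ | 0 < z + σ * u} ∩ {u : ℝ | 0 < z + σ * -u} := by
    rintro u ⟨h1, h2⟩
    have h1' : -z < max 1 σ * u := by
      have := mul_lt_mul_of_pos_left h1 hs
      rwa [mul_neg, mul_div_cancel₀ _ hs.ne'] at this
    have h2' : max 1 σ * u < z := by
      have := mul_lt_mul_of_pos_left h2 hs
      rwa [mul_div_cancel₀ _ hs.ne'] at this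
    have hle : σ ≤ max 1 σ := le_max_right _ _
    refine ⟨?_, ?_⟩
    · show 0 < z + σ * u
      rcases le_total 0 u with h | h <;> nlinarith
    · show 0 < z + σ * -u
      rcases le_total 0 u with h | h <;> nlinarith
  have hle := mul_le_measureReal_Ioo (a := -(z / max 1 σ)) (b := z / max 1 σ)
    (k := gaussianPDFReal 0 1 z) (by linarith [div_pos hz hs]) (by
      rintro u ⟨h1, h2⟩
      refine gaussianPDFReal_le_of_abs_le ?_
      rw [abs_of_pos hz]
      exact (abs_lt.2 ⟨h1, h2⟩).le.trans (div_le_self hz.le hs1))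
  have hmono := measureReal_mono (μ := gaussianReal 0 1) hsub
  rw [robustOneBitLink_eq]
  have e : 2 / max 1 σ * z * gaussianPDFReal 0 1 z
      = (z / max 1 σ - -(z / max 1 σ)) * gaussianPDFReal 0 1 z := by ring
  rw [e]
  linarith

/-- The constant `2 𝔼[Z² ϕ(Z)]`, where `ϕ` is the standard Gaussian density. -/
def robustConst : ℝ := 2 * ∫ z, z ^ 2 * gaussianPDFReal 0 1 z ∂(gaussianReal 0 1)

theorem gaussianPDFReal_le_one (z : ℝ) : gaussianPDFReal 0 1 z ≤ 1 := by
  simp only [gaussianPDFReal, NNReal.coe_one, sub_zero, mul_one]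
  have h1 : 1 ≤ √(2 * Real.pi) := Real.one_le_sqrt.2 (by linarith [Real.pi_gt_three])
  have h2 : Real.exp (-z ^ 2 / 2) ≤ 1 := Real.exp_le_one_iff.2 (by nlinarith [sq_nonneg z])
  exact mul_le_one₀ (inv_le_one_of_one_le₀ h1) (Real.exp_pos _).le h2

theorem integrable_sq_mul_gaussianPDFReal :
    Integrable (fun z => z ^ 2 * gaussianPDFReal 0 1 z) (gaussianReal 0 1) := by
  have := integrable_mul_pow_gaussianReal (f := gaussianPDFReal 0 1)
    (measurable_gaussianPDFReal 0 1) (fun z => by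
      rw [abs_of_nonneg (gaussianPDFReal_nonneg 0 1 z)]
      exact gaussianPDFReal_le_one z) 2
  simpa only [mul_comm] using this

theorem robustConst_pos : 0 < robustConst := by
  have := nullSingletonClass_gaussianReal (μ := 0) (v := 1) one_ne_zero
  refine mul_pos two_pos ((integral_pos_iff_support_of_nonneg (fun z =>
    mul_nonneg (sq_nonneg z) (gaussianPDFReal_nonneg 0 1 z))
    integrable_sq_mul_gaussianPDFReal).2 ?_)
  have hsub : ({0}ᶜ : Set ℝ) ⊆ Function.support fun z => z ^ 2 * gaussianPDFReal 0 1 z := by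
    intro z hz
    exact mul_ne_zero (pow_ne_zero 2 hz) (gaussianPDFReal_pos 0 1 z one_ne_zero).ne'
  refine lt_of_lt_of_le ?_ (measure_mono hsub)
  rw [prob_compl_eq_one_sub (measurableSet_singleton 0), measure_singleton]
  simp

theorem robustConst_div_le_mu_one {σ : ℝ} (hσ : 0 ≤ σ) :
    robustConst / max 1 σ ≤ mu (robustOneBitLink σ) 1 := by
  have e : robustConst / max 1 σ
      = ∫ z, 2 / max 1 σ * (z ^ 2 * gaussianPDFReal 0 1 z) ∂(gaussianReal 0 1) := by
    rw [integral_const_mul, robustConst]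
    ring
  rw [e]
  refine integral_mono (integrable_sq_mul_gaussianPDFReal.const_mul _)
    (integrable_mul_pow_gaussianReal (measurable_robustOneBitLink σ)
      (abs_robustOneBitLink_le σ) 1) fun z => ?_
  show 2 / max 1 σ * (z ^ 2 * gaussianPDFReal 0 1 z) ≤ robustOneBitLink σ z * z ^ 1
  rcases lt_trichotomy z 0 with h | h | h
  · have h1 := le_robustOneBitLink hσ (neg_pos.2 h)
    have h2 : gaussianPDFReal 0 1 (-z) = gaussianPDFReal 0 1 z :=
      le_antisymm (gaussianPDFReal_le_of_abs_le (by rw [abs_neg]))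
        (gaussianPDFReal_le_of_abs_le (by rw [abs_neg]))
    rw [robustOneBitLink_neg σ h.ne, h2] at h1
    nlinarith
  · simp [h]
  · have h1 := mul_le_mul_of_nonneg_right (le_robustOneBitLink hσ h) h.le
    linarith

theorem robustConst_sq_le_phi {σ : ℝ} (hσ : 0 ≤ σ) :
    (robustConst / max 1 σ) ^ 2 ≤ phi (robustOneBitLink σ) := by
  rw [phi_of_mu_zero (mu_zero_eq_zero_of_odd (measurable_robustOneBitLink σ)
    fun z hz => robustOneBitLink_neg σ hz)]
  have := robustConst_pos
  exact pow_le_pow_left₀ (by positivity) (robustConst_div_le_mu_one hσ) 2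

/-! ### One-bit phase retrieval -/

theorem measurable_phaseRetrievalLink (θ : ℝ) : Measurable (phaseRetrievalLink θ) := by
  have h : Measurable Real.sign := by
    unfold Real.sign
    exact Measurable.ite measurableSet_Iio measurable_const
      (Measurable.ite measurableSet_Ioi measurable_const measurable_const)
  exact h.comp (by fun_prop)

theorem abs_phaseRetrievalLink_le (θ z : ℝ) : |phaseRetrievalLink θ z| ≤ 1 := by
  rcases Real.sign_apply_eq (|z| - θ) with h | h | h <;> rw [phaseRetrievalLink, h] <;> norm_num

theorem phaseRetrievalLink_ae_eq (θ : ℝ) :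
    phaseRetrievalLink θ =ᵐ[gaussianReal 0 1]
      fun z => 1 - 2 * Set.indicator (Set.Ioo (-θ) θ) 1 z := by
  have := nullSingletonClass_gaussianReal (μ := 0) (v := 1) one_ne_zero
  have h1 : ∀ᵐ z ∂(gaussianReal 0 1), z ≠ θ := by simp [ae_iff]
  have h2 : ∀ᵐ z ∂(gaussianReal 0 1), z ≠ -θ := by simp [ae_iff]
  filter_upwards [h1, h2] with z hz1 hz2
  by_cases hz : z ∈ Set.Ioo (-θ) θ
  · rw [Set.indicator_of_mem hz, phaseRetrievalLink,
      Real.sign_of_neg (by linarith [abs_lt.2 hz])]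
    norm_num
  · have h3 : θ < |z| := by
      by_contra! h
      obtain ⟨h4, h5⟩ := abs_le.1 h
      exact hz ⟨lt_of_le_of_ne h4 hz2.symm, lt_of_le_of_ne h5 hz1⟩
    rw [Set.indicator_of_notMem hz, phaseRetrievalLink, Real.sign_of_pos (by linarith)]
    norm_num

theorem mu_phaseRetrievalLink (θ : ℝ) (k : ℕ) :
    mu (phaseRetrievalLink θ) k = ∫ z, z ^ k ∂(gaussianReal 0 1)
      - 2 * ∫ z in Set.Ioo (-θ) θ, z ^ k ∂(gaussianReal 0 1) := by
  have hi : Integrable (fun z : ℝ => z ^ k) (gaussianReal 0 1) := by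
    simpa using integrable_mul_pow_gaussianReal (f := fun _ => 1) (by fun_prop) (by simp) k
  rw [mu, ← integral_indicator measurableSet_Ioo, ← integral_const_mul,
    ← integral_sub hi ((hi.indicator measurableSet_Ioo).const_mul 2)]
  refine integral_congr_ae ((phaseRetrievalLink_ae_eq θ).mono fun z hz => ?_)
  simp only [hz]
  by_cases h : z ∈ Set.Ioo (-θ) θ
  · rw [Set.indicator_of_mem h, Set.indicator_of_mem h, Pi.one_apply]
    ring
  · rw [Set.indicator_of_notMem h, Set.indicator_of_notMem h]
    ring

theorem integral_sq_gaussianReal : ∫ z, z ^ 2 ∂(gaussianReal 0 1) = 1 := by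
  have h := variance_fun_id_gaussianReal (μ := 0) (v := 1)
  rw [variance_of_integral_eq_zero (by fun_prop) (by simp)] at h
  simpa using h

/-- Since `z ϕ(z)` is an antiderivative of `(1 - z²) ϕ(z)`. -/
theorem mu_zero_sub_mu_two_phaseRetrievalLink {θ : ℝ} (hθ : 0 ≤ θ) :
    mu (phaseRetrievalLink θ) 0 - mu (phaseRetrievalLink θ) 2
      = -4 * θ * gaussianPDFReal 0 1 θ := by
  have hI : ∀ k : ℕ, Integrable (fun z : ℝ => z ^ k) (gaussianReal 0 1) := fun k => by
    simpa using integrable_mul_pow_gaussianReal (f := fun _ => 1) (by fun_prop) (by simp) k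
  have hd : ∀ z : ℝ, HasDerivAt (fun z => z * gaussianPDFReal 0 1 z)
      (gaussianPDFReal 0 1 z * (1 - z ^ 2)) z := by
    intro z
    simp only [gaussianPDFReal, NNReal.coe_one, sub_zero, mul_one]
    have h1 : HasDerivAt (fun z : ℝ => -z ^ 2 / 2) (-z) z := by
      exact (((hasDerivAt_pow 2 z).neg).div_const 2).congr_deriv (by norm_num; ring)
    have h2 := (hasDerivAt_id z).mul (h1.exp.const_mul (√(2 * Real.pi))⁻¹)
    refine h2.congr_deriv ?_
    simp only [id]
    ring
  have hcont : Continuous fun z => gaussianPDFReal 0 1 z * (1 - z ^ 2) := by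
    unfold gaussianPDFReal
    fun_prop
  have hftc := intervalIntegral.integral_eq_sub_of_hasDerivAt (a := -θ) (b := θ)
    (fun z _ => hd z) (hcont.intervalIntegrable _ _)
  have hset : ∫ z in Set.Ioo (-θ) θ, (1 - z ^ 2) ∂(gaussianReal 0 1)
      = 2 * θ * gaussianPDFReal 0 1 θ := by
    rw [intervalIntegral.integral_of_le (by linarith), integral_Ioc_eq_integral_Ioo] at hftc
    have heven : gaussianPDFReal 0 1 (-θ) = gaussianPDFReal 0 1 θ :=
      le_antisymm (gaussianPDFReal_le_of_abs_le (by rw [abs_neg]))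
        (gaussianPDFReal_le_of_abs_le (by rw [abs_neg]))
    rw [heven] at hftc
    rw [← integral_indicator measurableSet_Ioo,
      integral_gaussianReal_eq_integral_smul one_ne_zero]
    have e : (fun z : ℝ => gaussianPDFReal 0 1 z • (Set.Ioo (-θ) θ).indicator
        (fun z => 1 - z ^ 2) z)
        = (Set.Ioo (-θ) θ).indicator fun z => gaussianPDFReal 0 1 z * (1 - z ^ 2) := by
      ext z
      by_cases h : z ∈ Set.Ioo (-θ) θ
      · rw [Set.indicator_of_mem h, Set.indicator_of_mem h, smul_eq_mul]
      · rw [Set.indicator_of_notMem h, Set.indicator_of_notMem h, smul_zero]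
    rw [e, integral_indicator measurableSet_Ioo, hftc]
    ring
  rw [mu_phaseRetrievalLink, mu_phaseRetrievalLink, integral_sq_gaussianReal]
  have hsub := integral_sub ((hI 0).integrableOn (s := Set.Ioo (-θ) θ))
    ((hI 2).integrableOn (s := Set.Ioo (-θ) θ))
  simp only [pow_zero] at hsub
  rw [hset] at hsub
  simp only [pow_zero, integral_const, probReal_univ, smul_eq_mul, mul_one] at hsub ⊢
  linarith

theorem pos_of_measureReal_abs_ge {θm : ℝ}
    (hm : (gaussianReal 0 1).real {z : ℝ | θm ≤ |z|} = 1 / 2) : 0 < θm := by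
  by_contra! h
  have : {z : ℝ | θm ≤ |z|} = Set.univ := Set.eq_univ_of_forall fun z => h.trans (abs_nonneg z)
  rw [this, probReal_univ] at hm
  norm_num at hm

theorem mu_zero_phaseRetrievalLink_le {θm θ : ℝ}
    (hm : (gaussianReal 0 1).real {z : ℝ | θm ≤ |z|} = 1 / 2) (hθ : θm < θ) :
    mu (phaseRetrievalLink θ) 0 ≤ -(2 * (θ - θm) * gaussianPDFReal 0 1 θ) := by
  have hm0 := pos_of_measureReal_abs_ge hm
  have hmeas : MeasurableSet {z : ℝ | θm ≤ |z|} := measurableSet_le (by fun_prop) (by fun_prop)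
  have hc := probReal_compl_eq_one_sub (μ := gaussianReal 0 1) hmeas
  rw [hm] at hc
  have hdis : Disjoint {z : ℝ | θm ≤ |z|}ᶜ (Set.Ioo θm θ) := by
    rw [Set.disjoint_left]
    intro z hz hz'
    exact hz (hz'.1.le.trans (le_abs_self z))
  have hsub : {z : ℝ | θm ≤ |z|}ᶜ ∪ Set.Ioo θm θ ⊆ Set.Ioo (-θ) θ := by
    rintro z (hz | hz)
    · have hz' : |z| < θm := not_le.1 hz
      exact abs_lt.1 (hz'.trans hθ)
    · exact ⟨by linarith [hz.1], hz.2⟩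
  have h1 := measureReal_mono (μ := gaussianReal 0 1) hsub
  rw [measureReal_union hdis measurableSet_Ioo, hc] at h1
  have h2 := mul_le_measureReal_Ioo (k := gaussianPDFReal 0 1 θ) hθ.le (by
    rintro z ⟨h1, h2⟩
    refine gaussianPDFReal_le_of_abs_le ?_
    rw [abs_of_pos (hm0.trans h1), abs_of_pos (hm0.trans hθ)]
    exact h2.le)
  rw [mu_phaseRetrievalLink]
  simp only [pow_zero, integral_const, probReal_univ, smul_eq_mul, mul_one,
    measureReal_restrict_apply_univ]
  linarith

theorem le_phi_phaseRetrievalLink {θm θ : ℝ}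
    (hm : (gaussianReal 0 1).real {z : ℝ | θm ≤ |z|} = 1 / 2) (hθ : θm < θ) :
    4 / Real.pi * (θ * (θ - θm) * Real.exp (-θ ^ 2)) ≤ phi (phaseRetrievalLink θ) := by
  have hm0 := pos_of_measureReal_abs_ge hm
  have hθ0 : 0 < θ := hm0.trans hθ
  have h1 := mu_zero_sub_mu_two_phaseRetrievalLink hθ0.le
  have h2 := mu_zero_phaseRetrievalLink_le hm hθ
  have hg := gaussianPDFReal_nonneg 0 1 θ
  have hsq : gaussianPDFReal 0 1 θ ^ 2 = Real.exp (-θ ^ 2) / (2 * Real.pi) := by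
    simp only [gaussianPDFReal, NNReal.coe_one, sub_zero, mul_one]
    rw [mul_pow, inv_pow, Real.sq_sqrt (by positivity), ← Real.exp_nat_mul, mul_comm, div_eq_mul_inv]
    congr 2
    push_cast
    ring
  -- `φ = μ₁² + (-μ₀) (μ₂ - μ₀)`, and both factors of the product are positive.
  have h3 : phi (phaseRetrievalLink θ) = mu (phaseRetrievalLink θ) 1 ^ 2
      + -mu (phaseRetrievalLink θ) 0 * (4 * θ * gaussianPDFReal 0 1 θ) := by
    rw [phi]
    linear_combination mu (phaseRetrievalLink θ) 0 * h1
  have h4 : 2 * (θ - θm) * gaussianPDFReal 0 1 θ * (4 * θ * gaussianPDFReal 0 1 θ)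
      ≤ -mu (phaseRetrievalLink θ) 0 * (4 * θ * gaussianPDFReal 0 1 θ) :=
    mul_le_mul_of_nonneg_right (by linarith) (by positivity)
  have h5 : 2 * (θ - θm) * gaussianPDFReal 0 1 θ * (4 * θ * gaussianPDFReal 0 1 θ)
      = 4 / Real.pi * (θ * (θ - θm) * Real.exp (-θ ^ 2)) := by
    have : 2 * (θ - θm) * gaussianPDFReal 0 1 θ * (4 * θ * gaussianPDFReal 0 1 θ)
      = 8 * (θ * (θ - θm)) * gaussianPDFReal 0 1 θ ^ 2 := by ring
    rw [this, hsq]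
    have := Real.pi_pos
    field_simp
    ring
  rw [h3, ← h5]
  linarith [sq_nonneg (mu (phaseRetrievalLink θ) 1)]

end Models

/-! ### The error rate -/

section Rate

theorem gam_mem {f : ℝ → ℝ} (hf1 : ∀ z, |f z| ≤ 1) (hφ : 0 < phi f) : 0 ≤ gam f ∧ gam f < 1 := by
  have hc : 0 ≤ 1 - mu f 0 ^ 2 := by
    have := (sq_le_one_iff_abs_le_one _).2 (abs_mu_zero_le hf1)
    linarith
  have hpos : 0 < phi f + 1 - mu f 0 ^ 2 := by linarith
  have h1 : (1 - mu f 0 ^ 2) / (phi f + 1 - mu f 0 ^ 2) < 1 := (div_lt_one hpos).2 (by linarith)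
  have h2 : 0 ≤ (1 - mu f 0 ^ 2) / (phi f + 1 - mu f 0 ^ 2) := div_nonneg hc hpos.le
  unfold gam
  constructor <;> linarith

theorem xi_pos {f : ℝ → ℝ} (hf1 : ∀ z, |f z| ≤ 1) (hφ : 0 < phi f) : 0 < xi f := by
  have hc : 0 ≤ 1 - mu f 0 ^ 2 := by
    have := (sq_le_one_iff_abs_le_one _).2 (abs_mu_zero_le hf1)
    linarith
  have hpos : 0 < phi f + 1 - mu f 0 ^ 2 := by linarith
  have hnum : gam f * phi f + (gam f - 1) * (1 - mu f 0 ^ 2) = phi f / 2 := by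
    unfold gam
    field_simp
    ring
  have := (gam_mem hf1 hφ).1
  rw [xi, hnum]
  positivity

/-- If `C₃ r √(p / n) ≥ 2` the error bound is trivial, because the iterates have norm at most `1`.
Otherwise `√(p / n)` is at most a small multiple of `1 / r ≤ φ / c₀`, so that on the event of
concentration the moment matrix is within `φ / 4` of its expectation. -/
theorem attainsRate_of_le_mul_phi {c₀ C₃ : ℝ} (hc₀ : 0 < c₀)
    (hC₃ : 512 + 128 * (varProxy + 1 + Real.log 5) / c₀ ≤ C₃) {f : ℝ → ℝ} {r : ℝ}
    (hf : Measurable f) (hf1 : ∀ z, |f z| ≤ 1) (hφ : 0 < phi f) (hr : 1 ≤ r)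
    (hrφ : c₀ ≤ r * phi f) : AttainsRate.{u} 1 1 C₃ f r := by
  intro Ω _ P _ p n βs y x hβs hn hCn hS
  set K := 4 * (varProxy + 1 + Real.log 5) with hK
  have hK0 : 0 ≤ K := by
    have := varProxy_nonneg
    have := Real.log_nonneg (by norm_num : (1 : ℝ) ≤ 5)
    positivity
  have hC₃' : 512 + 32 * (K / c₀) ≤ C₃ := by
    refine le_of_eq_of_le ?_ hC₃
    rw [hK]
    ring
  have hKc : 0 ≤ K / c₀ := by positivity
  have hC₃0 : 0 < C₃ := by linarith
  have hr0 : 0 < r := by linarith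
  obtain ⟨hγ0, hγ1⟩ := gam_mem hf1 hφ
  have hp0 : 0 < p := by
    rcases Nat.eq_zero_or_pos p with rfl | h
    · rw [Subsingleton.elim βs 0, norm_zero] at hβs
      norm_num at hβs
    · exact h
  have hp0' : (0 : ℝ) < p := by exact_mod_cast hp0
  have hn0' : (0 : ℝ) < n := by
    have := xi_pos hf1 hφ
    have : 0 < 1 * (p : ℝ) / xi f ^ 2 := by positivity
    linarith
  have hn0 : 0 < n := by exact_mod_cast hn0'
  set q := √((p : ℝ) / n) with hq
  have hq0 : 0 < q := Real.sqrt_pos.2 (by positivity)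
  have hev : ∀ α : ℝ, ∃ T₀ : ℕ, ∀ T ≥ T₀, optError f α T ≤ r * q := by
    intro α
    have hlim : Filter.Tendsto (fun T => optError f α T) Filter.atTop (nhds 0) := by
      have := (tendsto_pow_atTop_nhds_zero_of_lt_one hγ0 hγ1).const_mul (√((1 - α ^ 2) / α ^ 2))
      rwa [mul_zero] at this
    exact Filter.eventually_atTop.1 (hlim.eventually_le_const (by positivity))
  rcases le_or_gt 2 (C₃ * (r * q)) with htriv | hsmall
  · refine ⟨Set.univ, MeasurableSet.univ, ?_, ?_⟩
    · rw [probReal_univ]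
      linarith [Real.exp_pos (-1 * (p : ℝ))]
    · intro ω _ β₀ v hβ₀ _ _ _
      refine ⟨hev _, fun T _ => le_trans ?_ htriv⟩
      have h1 := norm_powerIterate_le (momentMatrix (y · ω) (x · ω)) hβ₀.le T
      have h2 : ‖Real.sign ⟪β₀, v⟫ • βs‖ ≤ 1 := by
        rw [norm_smul, hβs, mul_one]
        rcases Real.sign_apply_eq ⟪β₀, v⟫ with h | h | h <;> rw [h] <;> norm_num
      exact (norm_sub_le _ _).trans (by linarith)
  -- Twice `K q`, with `q = √(p / n)`, bounds the perturbation of the moment matrix; it is at most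
  -- `φ / 4` because `K q ≤ (K / c₀) (r q) φ` and `r q < 2 / C₃`.
  · have hrq : r * q ≤ 1 / 256 := by nlinarith [mul_pos hr0 hq0, mul_nonneg hKc (mul_pos hr0 hq0).le]
    have hKrq : K / c₀ * (r * q) ≤ 1 / 16 := by
      nlinarith [mul_pos hr0 hq0, mul_nonneg hKc (mul_pos hr0 hq0).le]
    have hq1 : q ≤ r * q := le_mul_of_one_le_left hq0.le hr
    have hqm : √((p : ℝ) / (n / 2 : ℕ)) ≤ 2 * q := by
      have hnm : (n : ℝ) = 2 * (n / 2 : ℕ) := by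
        have : n = 2 * (n / 2) := by
          obtain ⟨k, rfl⟩ := hn
          omega
        exact_mod_cast this
      have hm0 : (0 : ℝ) < (n / 2 : ℕ) := by linarith
      refine Real.sqrt_le_iff.2 ⟨by positivity, ?_⟩
      rw [mul_pow, hq, Real.sq_sqrt (by positivity), hnm, ← mul_div_assoc, div_le_div_iff₀ hm0
        (by positivity)]
      nlinarith [mul_pos hp0' hm0]
    obtain ⟨G, hGm, hGP, hG⟩ := hS.exists_concentration hn hn0 hβs hf hf1 (by linarith)
    refine ⟨G, hGm, ?_, ?_⟩
    · rwa [neg_one_mul]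
    intro ω hω β₀ v hβ₀ hv hvβ hα
    refine ⟨hev _, fun T hT => ?_⟩
    have hKφ : K * q ≤ K / c₀ * (r * q) * phi f := by
      have : K / c₀ * (r * q) * phi f = K * q * (r * phi f) / c₀ := by ring
      rw [this, le_div_iff₀ hc₀]
      exact mul_le_mul_of_nonneg_left hrφ (by positivity)
    have hpert : ∀ z, ‖((momentMatrix (y · ω) (x · ω)).toEuclideanLin -
        spiked (4 * (1 - mu f 0 ^ 2)) (4 * phi f) βs) z‖ ≤ 2 * K * q * ‖z‖ := by
      intro z
      refine (hG ω hω z).trans (mul_le_mul_of_nonneg_right ?_ (norm_nonneg z))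
      rw [← mul_assoc, ← hK]
      nlinarith
    have hc : 0 ≤ 1 - mu f 0 ^ 2 := by
      have := (sq_le_one_iff_abs_le_one _).2 (abs_mu_zero_le hf1)
      linarith
    have hmain := norm_powerIterate_sub_le_of_perturbation (isSymmetric_momentMatrix _ _) hc hφ
      (by nlinarith) hβs hpert hv hvβ hβ₀ hα T
    have hgam : ((1 - mu f 0 ^ 2) / (phi f + (1 - mu f 0 ^ 2)) + 1) / 2 = gam f := by
      rw [gam, add_sub_assoc]
    rw [hgam] at hmain
    refine hmain.trans ?_
    have h1 : 2 * K * q / phi f ≤ 2 * (K / c₀ * (r * q)) := by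
      rw [div_le_iff₀ hφ]
      linarith
    have h2 : √((1 - ⟪β₀, v⟫ ^ 2) / ⟪β₀, v⟫ ^ 2) * gam f ^ T ≤ r * q := hT
    have h3 := mul_le_mul_of_nonneg_right hC₃' (mul_pos hr0 hq0).le
    nlinarith [mul_pos hr0 hq0, mul_nonneg hKc (mul_pos hr0 hq0).le]

end Rate

end OneBit

end

theorem mainTheorem7 :
    ∃ C₁ C₂ C₃ : ℝ, 0 < C₁ ∧ 0 < C₂ ∧ 0 < C₃ ∧
      (∀ pe : ℝ, 0 ≤ pe → pe < 1 / 2 →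
        0 < OneBit.phi (OneBit.flippedLogisticLink pe) ∧
        OneBit.AttainsRate.{u} C₁ C₂ C₃ (OneBit.flippedLogisticLink pe)
          (max 1 (1 / (1 - 2 * pe) ^ 2))) ∧
      (∀ σ : ℝ, 0 ≤ σ →
        0 < OneBit.phi (OneBit.robustOneBitLink σ) ∧
        OneBit.AttainsRate.{u} C₁ C₂ C₃ (OneBit.robustOneBitLink σ) (max 1 (σ ^ 2))) ∧
      (∀ θm θ : ℝ, (gaussianReal 0 1).real {z : ℝ | θm ≤ |z|} = 1 / 2 → θm < θ →
        0 < OneBit.phi (OneBit.phaseRetrievalLink θ) ∧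
        OneBit.AttainsRate.{u} C₁ C₂ C₃ (OneBit.phaseRetrievalLink θ)
          (max 1 (1 / (θ * (θ - θm) * Real.exp (-θ ^ 2))))) := by
  -- `c₁`, `c₂` and `4 / π` are the lower bounds for `r φ(f)` in the three models.
  set c₁ := OneBit.mu (OneBit.flippedLogisticLink 0) 1 ^ 2
  set c₂ := OneBit.robustConst ^ 2
  have h₁ : 0 < c₁ := pow_pos OneBit.mu_one_flippedLogisticLink_zero_pos 2
  have h₂ : 0 < c₂ := pow_pos OneBit.robustConst_pos 2
  have h₃ : 0 < 4 / Real.pi := by positivity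
  set c₀ := min c₁ (min c₂ (4 / Real.pi))
  have h₀ : 0 < c₀ := lt_min h₁ (lt_min h₂ h₃)
  have hK : 0 ≤ 128 * (OneBit.varProxy + 1 + Real.log 5) / c₀ := by
    have := OneBit.varProxy_nonneg
    have := Real.log_nonneg (by norm_num : (1 : ℝ) ≤ 5)
    positivity
  refine ⟨1, 1, 512 + 128 * (OneBit.varProxy + 1 + Real.log 5) / c₀, one_pos, one_pos,
    by linarith, ?_, ?_, ?_⟩
  · intro pe h0 h1
    have hpos : 0 < (1 - 2 * pe) ^ 2 := pow_pos (by linarith) 2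
    have hφ : OneBit.phi (OneBit.flippedLogisticLink pe) = (1 - 2 * pe) ^ 2 * c₁ :=
      OneBit.phi_flippedLogisticLink pe
    have hφ0 : 0 < OneBit.phi (OneBit.flippedLogisticLink pe) := by
      rw [hφ]
      positivity
    refine ⟨hφ0, OneBit.attainsRate_of_le_mul_phi h₀ le_rfl
      (OneBit.measurable_flippedLogisticLink pe) (OneBit.abs_flippedLogisticLink_le h0 h1) hφ0
      (le_max_left _ _) ?_⟩
    calc c₀ ≤ c₁ := min_le_left _ _
      _ = 1 / (1 - 2 * pe) ^ 2 * OneBit.phi (OneBit.flippedLogisticLink pe) := by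
        rw [hφ, one_div, inv_mul_cancel_left₀ hpos.ne']
      _ ≤ _ := mul_le_mul_of_nonneg_right (le_max_right _ _) hφ0.le
  · intro σ hσ
    have hφ := OneBit.robustConst_sq_le_phi hσ
    have hs : 0 < max 1 σ := lt_max_of_lt_left one_pos
    rw [div_pow] at hφ
    have hφ0 : 0 < OneBit.phi (OneBit.robustOneBitLink σ) :=
      lt_of_lt_of_le (by positivity) hφ
    refine ⟨hφ0, OneBit.attainsRate_of_le_mul_phi h₀ le_rfl
      (OneBit.measurable_robustOneBitLink σ) (OneBit.abs_robustOneBitLink_le σ) hφ0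
      (le_max_left _ _) ?_⟩
    have hmax : max 1 σ ^ 2 ≤ max 1 (σ ^ 2) := by
      rcases le_total 1 σ with h | h
      · rw [max_eq_right h]
        exact le_max_right _ _
      · rw [max_eq_left h, one_pow]
        exact le_max_left _ _
    calc c₀ ≤ c₂ := (min_le_right _ _).trans (min_le_left _ _)
      _ = max 1 σ ^ 2 * (c₂ / max 1 σ ^ 2) := by field_simp
      _ ≤ _ := mul_le_mul hmax hφ (by positivity) (by positivity)
  · intro θm θ hm hθ
    have hθm := OneBit.pos_of_measureReal_abs_ge hm
    have hX : 0 < θ * (θ - θm) * Real.exp (-θ ^ 2) :=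
      mul_pos (mul_pos (hθm.trans hθ) (by linarith)) (Real.exp_pos _)
    have hφ := OneBit.le_phi_phaseRetrievalLink hm hθ
    have hφ0 : 0 < OneBit.phi (OneBit.phaseRetrievalLink θ) :=
      lt_of_lt_of_le (mul_pos h₃ hX) hφ
    refine ⟨hφ0, OneBit.attainsRate_of_le_mul_phi h₀ le_rfl
      (OneBit.measurable_phaseRetrievalLink θ) (OneBit.abs_phaseRetrievalLink_le θ) hφ0
      (le_max_left _ _) ?_⟩
    calc c₀ ≤ 4 / Real.pi := (min_le_right _ _).trans (min_le_right _ _)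
      _ = 1 / (θ * (θ - θm) * Real.exp (-θ ^ 2))
          * (4 / Real.pi * (θ * (θ - θm) * Real.exp (-θ ^ 2))) := by
        rw [mul_left_comm, one_div, inv_mul_cancel₀ hX.ne', mul_one]
      _ ≤ _ := mul_le_mul (le_max_right _ _) hφ (by positivity) (by positivity)
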